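/- For all real constants $c_1,c_2,c_3,c_4$ there is a constant $K>0$, depending only on $c_1,c_2,c_3,c_4$, such that the following holds. Let $p$ be a prime, let $\mathbb{F}_{p^2}\subseteq\mathbb{F}_{p^4}$ be the finite fields with $p^2$ and $p^4$ elements, and let $t$ be a defining element of $\mathbb{F}_{p^4}$ over $\mathbb{F}_{p^2}$, i.e. $\mathbb{F}_{p^4}=\mathbb{F}_{p^2}(t)$, so that $\mathbb{F}_{p^4}=\mathbb{F}_{p^2}+t\,\mathbb{F}_{p^2}$. Let $P\subseteq\mathbb{F}_{p^4}\times\mathbb{F}_{p^4}$ with $|P|=n$ and $p^{6419/2560}\le c_1 n$, and let $A=\{x:(x,y)\in P\}$ be its projection to the $x$-axis. Suppose that $|A|\le c_2p^2$ and that $A=\bigcup_{j\in J}A_j$, where $J\subseteq\mathbb{F}_{p^2}$ satisfies $$|J|\le c_3\max\{p,\,n^{2560/6419}\},$$ and where, for each $j\in J$, $A_j\subseteq\mathbb{F}_{p^2}+jt$ satisfies $$|A_j|\le c_4\max\{p,\,n^{2560/6419}\}.$$ (In particular this covers the case in which $A_j\subseteq\mathbb{F}_p+jt$ for each $j\in J$.)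 Then for every set $L$ of lines in $\mathbb{F}_{p^4}\times\mathbb{F}_{p^4}$ with $|L|=n$, the number of incidences $I(P,L)=|\{(x,l)\in P\times L : x\in l\}|$ satisfies $$I(P,L)\le K\,n^{\frac32-\frac1{12838}}.$$ -/

import Mathlib

/-- A line in the affine plane `F × F`: a one-dimensional affine subspace
(the empty subspace has direction `⊥`, so it is not a line). -/
def IsLine {F : Type*} [Field F] (l : AffineSubspace F (F × F)) : Prop :=
  Module.finrank F l.direction = 1

open Classical in
/-- The number `I(P, L)` of incidences `(p, l) ∈ P × L` with `p ∈ l`. -/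
noncomputable def incidences {F : Type*} [Field F] (P : Finset (F × F))
    (L : Finset (AffineSubspace F (F × F))) : ℕ :=
  ((P ×ˢ L).filter (fun x => x.1 ∈ x.2)).card

/-! Put N = √n and κ = n^(1/12838), and suppose that there are more than N³/κ incidences. Counting
paths line–point–line–point yields a centre o ∈ P such that about N³ pairs of lines (l, l') meet in
P with o on l' only, up to powers of κ (`exists_center`). A projective change of coordinates makes
each line l off o a point of the plane and each slope d of a line through o a direction. The
projection of l in direction d is then (x - o₁)⁻¹, where x is the abscissa of the point at which l
meets the line of slope d. So at most N² points have about N projections that often fall in sets of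
size at most 2N.

Such a configuration comes from a subfield (`exists_subfield_of_small_projections`). Two of the
directions serve as coordinates. Balog–Szemerédi–Gowers and Ruzsa's triangle inequality produce a
set A₀ of inverted abscissae and a set X₁ of multipliers, both of size about N, with A₀ + yA₀ small
for all y ∈ X₁. The pivot argument on quotients of differences puts X₁ in a subfield R of size at
most about N (`card_sq_le_or_exists_subfield`), and an energy count puts a large part A' of A₀ in an
affine copy cR + e.

The hypotheses on the abscissae exclude this. A single line already carries N/(8κ) abscissae, so p²
is at least about N. Hence R is too small to be the whole field and is fixed by σ : x ↦ x^(p²). The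
Möbius image z + 1/(cg + e), g ∈ R, meets each coset of 𝔽_{p²} in at most two points, one coset jt +
𝔽_{p²} excepted (`card_le_of_mobius`). So |A'| ≤ 2|J| + max |A_j|, about n^(2560/6419), far below N.
-/

section
open Finset
open scoped Pointwise

/-! ### Double counting and the Balog–Szemerédi–Gowers graph lemma. -/

/-- Cauchy–Schwarz in cardinality form: a map into a small set has many collisions. -/
theorem card_sq_le_card_mul_collisions {ι κ : Type*} [DecidableEq κ]
    (S : Finset ι) (C : Finset κ) (f : ι → κ) (hf : ∀ s ∈ S, f s ∈ C) :
    (S.card : ℝ) ^ 2 ≤ C.card * ((S ×ˢ S).filter (fun x => f x.1 = f x.2)).card := by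
  have h1 : (S.card : ℝ) = ∑ c ∈ C, ((S.filter (fun s => f s = c)).card : ℝ) := by
    exact_mod_cast card_eq_sum_card_fiberwise (fun s hs => hf s hs)
  have h2 : (((S ×ˢ S).filter (fun x => f x.1 = f x.2)).card : ℝ)
      = ∑ c ∈ C, ((S.filter (fun s => f s = c)).card : ℝ) ^ 2 := by
    rw [card_eq_sum_card_fiberwise (s := (S ×ˢ S).filter (fun x => f x.1 = f x.2)) (t := C)
      (f := fun x => f x.1) (fun x hx => hf _ (mem_product.1 (mem_filter.1 hx).1).1)]
    push_cast
    refine sum_congr rfl fun c _ => ?_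
    rw [sq, ← Nat.cast_mul, ← card_product]
    congr 2
    ext ⟨x, y⟩
    simp only [mem_filter, mem_product]
    grind
  rw [h1, h2]
  exact sq_sum_le_card_mul_sum_sq

theorem sum_card_filter_comm {α β : Type*} (A : Finset α) (B : Finset β) (r : α → β → Prop)
    [∀ a b, Decidable (r a b)] :
    ∑ a ∈ A, ((B.filter (fun b => r a b)).card : ℝ)
      = ∑ b ∈ B, ((A.filter (fun a => r a b)).card : ℝ) := by
  exact_mod_cast sum_card_bipartiteAbove_eq_sum_card_bipartiteBelow r

/-- Removing the terms below `w` costs at most `w` times the number of terms. -/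
theorem sum_le_sum_filter_add {ι : Type*} (S : Finset ι) (f : ι → ℝ) (w T : ℝ)
    (hw : 0 ≤ w) (hT : (S.card : ℝ) ≤ T) :
    ∑ s ∈ S, f s ≤ ∑ s ∈ S.filter (fun s => w ≤ f s), f s + w * T := by
  rw [← sum_filter_add_sum_filter_not S (fun s => w ≤ f s)]
  have : ∑ s ∈ S.filter (fun s => ¬ w ≤ f s), f s ≤ w * T := by
    calc _ ≤ ∑ s ∈ S.filter (fun s => ¬ w ≤ f s), w :=
          sum_le_sum fun s hs => (not_le.1 (mem_filter.1 hs).2).le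
      _ = (S.filter (fun s => ¬ w ≤ f s)).card * w := by simp
      _ ≤ T * w := by
          gcongr
          exact le_trans (by exact_mod_cast card_filter_le _ _) hT
      _ = _ := mul_comm _ _
  linarith

set_option maxHeartbeats 400000 in
/-- The graph-theoretic core of the Balog–Szemerédi–Gowers theorem: a dense bipartite graph has
large subsets of both sides all of whose pairs are joined by many paths of length three. -/
theorem exists_many_paths_three {α β : Type*} [DecidableEq α] [DecidableEq β]
    (A : Finset α) (B : Finset β) (r : α → β → Prop) [∀ a b, Decidable (r a b)]
    (M K : ℝ) (hM : 0 < M) (hK : 0 < K) (hA : (A.card : ℝ) ≤ M) (hB : (B.card : ℝ) ≤ M)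
    (hE : M ^ 2 / K ≤ ∑ a ∈ A, ((B.filter (fun b => r a b)).card : ℝ)) :
    ∃ A' ⊆ A, ∃ B' ⊆ B, M / (6 * K) ≤ A'.card ∧ M / (4 * K) ≤ B'.card ∧
      ∀ a ∈ A', ∀ b ∈ B', M ^ 2 / (2 ^ 12 * K ^ 5) ≤
        ((A ×ˢ B).filter (fun x => r a x.2 ∧ r x.1 x.2 ∧ r x.1 b)).card := by
  -- With θ = M/(128K³), bad pairs penalised by the weight 16K cost exactly half of the second
  -- moment M³/(4K²).
  have e1 : M ^ 3 / (4 * K ^ 2) =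
      M * (M ^ 2 / (8 * K ^ 2)) + 16 * K * (M / (128 * K ^ 3) * M ^ 2) := by
    field_simp; ring
  have e2 : ∀ x : ℝ, x ^ 2 / (16 * K) = (x / 2) * (x / (8 * K)) := fun x => by ring
  set A1 := A.filter (fun a => M / (2 * K) ≤ ((B.filter (fun b => r a b)).card : ℝ)) with hA1
  have hA1A : A1 ⊆ A := filter_subset _ _
  have hA1M : (A1.card : ℝ) ≤ M := le_trans (by exact_mod_cast card_le_card hA1A) hA
  have hE1 : M ^ 2 / (2 * K) ≤ ∑ a ∈ A1, ((B.filter (fun b => r a b)).card : ℝ) := by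
    have := sum_le_sum_filter_add A (fun a => ((B.filter (fun b => r a b)).card : ℝ))
      (M / (2 * K)) M (by positivity) hA
    have e : M ^ 2 / K = M ^ 2 / (2 * K) + M / (2 * K) * M := by ring
    linarith
  -- codegree and bad pairs
  let cod : α × α → ℝ := fun x => ((B.filter (fun b => r x.1 b ∧ r x.2 b)).card : ℝ)
  set θ : ℝ := M / (128 * K ^ 3) with hθ
  let bad : Finset (α × α) := (A1 ×ˢ A1).filter (fun x => cod x < θ)
  let N : β → Finset α := fun b => A1.filter (fun a => r a b)
  have hN1 : M ^ 2 / (2 * K) ≤ ∑ b ∈ B, ((N b).card : ℝ) := by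
    rw [sum_card_filter_comm] at hE1; exact hE1
  have hN2 : M ^ 3 / (4 * K ^ 2) ≤ ∑ b ∈ B, ((N b).card : ℝ) ^ 2 := by
    have h1 : (∑ b ∈ B, ((N b).card : ℝ)) ^ 2 ≤ B.card * ∑ b ∈ B, ((N b).card : ℝ) ^ 2 :=
      sq_sum_le_card_mul_sum_sq
    have h2 : (M ^ 2 / (2 * K)) ^ 2 ≤ (∑ b ∈ B, ((N b).card : ℝ)) ^ 2 :=
      pow_le_pow_left₀ (by positivity) hN1 2
    have h3 : (B.card : ℝ) * ∑ b ∈ B, ((N b).card : ℝ) ^ 2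
        ≤ M * ∑ b ∈ B, ((N b).card : ℝ) ^ 2 :=
      mul_le_mul_of_nonneg_right hB (sum_nonneg fun _ _ => sq_nonneg _)
    have e : (M ^ 2 / (2 * K)) ^ 2 = M * (M ^ 3 / (4 * K ^ 2)) := by ring
    rw [e] at h2
    exact le_of_mul_le_mul_left (h2.trans (h1.trans h3)) hM
  let bd : β → ℝ := fun b => ((bad.filter (fun x => r x.1 b ∧ r x.2 b)).card : ℝ)
  have hbd : ∑ b ∈ B, bd b ≤ θ * M ^ 2 := by
    have e : ∑ b ∈ B, bd b = ∑ x ∈ bad, cod x :=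
      (sum_card_filter_comm bad B (fun x b => r x.1 b ∧ r x.2 b)).symm
    rw [e]
    calc _ ≤ ∑ x ∈ bad, θ := sum_le_sum fun x hx => (mem_filter.1 hx).2.le
      _ = bad.card * θ := by simp
      _ ≤ M ^ 2 * θ := by
          gcongr
          have : (bad.card : ℝ) ≤ A1.card * A1.card := by
            rw [← Nat.cast_mul, ← card_product]; exact_mod_cast card_filter_le _ _
          nlinarith [Nat.cast_nonneg (α := ℝ) A1.card]
      _ = _ := mul_comm _ _
  -- Averaging over b gives one neighbourhood that is large and in which bad pairs form at most a
  -- 1/(16K) share of all pairs.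
  obtain ⟨b0, -, hb0⟩ : ∃ b ∈ B, M ^ 2 / (8 * K ^ 2) ≤ ((N b).card : ℝ) ^ 2 - 16 * K * bd b := by
    by_contra! hcon
    have hBne : B.Nonempty := by
      rw [nonempty_iff_ne_empty]; rintro rfl
      simp at hN2
      have : 0 < M ^ 3 / (4 * K ^ 2) := by positivity
      linarith
    have h1 : ∑ b ∈ B, (((N b).card : ℝ) ^ 2 - 16 * K * bd b) < ∑ b ∈ B, M ^ 2 / (8 * K ^ 2) :=
      sum_lt_sum_of_nonempty hBne hcon
    rw [sum_sub_distrib, ← mul_sum] at h1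
    have h2 : ∑ b ∈ B, M ^ 2 / (8 * K ^ 2) ≤ M * (M ^ 2 / (8 * K ^ 2)) := by
      simp only [sum_const, nsmul_eq_mul]
      exact mul_le_mul_of_nonneg_right hB (by positivity)
    have h3 : 16 * K * ∑ b ∈ B, bd b ≤ 16 * K * (θ * M ^ 2) :=
      mul_le_mul_of_nonneg_left hbd (by positivity)
    linarith
  set A2 := N b0 with hA2
  have hA2A1 : A2 ⊆ A1 := filter_subset _ _
  have hA2card : M / (3 * K) ≤ A2.card := by
    have h0 : 0 ≤ 16 * K * bd b0 := by positivity
    have : (M / (3 * K)) ^ 2 ≤ (A2.card : ℝ) ^ 2 := by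
      calc (M / (3 * K)) ^ 2 = M ^ 2 / (9 * K ^ 2) := by ring
        _ ≤ M ^ 2 / (8 * K ^ 2) := by gcongr; norm_num
        _ ≤ _ := by linarith
    exact le_of_sq_le_sq this (by positivity)
  have hA2pos : (0 : ℝ) < A2.card := lt_of_lt_of_le (by positivity) hA2card
  have hbadA2 : bd b0 ≤ (A2.card : ℝ) ^ 2 / (16 * K) := by
    rw [le_div_iff₀ (by positivity)]
    have : 0 ≤ M ^ 2 / (8 * K ^ 2) := by positivity
    linarith
  let q : α → ℝ := fun a => ((A2.filter (fun a' => cod (a, a') < θ)).card : ℝ)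
  have hq : ∑ a ∈ A2, q a ≤ (A2.card : ℝ) ^ 2 / (16 * K) := by
    refine le_trans (le_of_eq ?_) hbadA2
    simp only [q, bd, ← Nat.cast_sum, ← card_sigma]
    congr 1
    refine card_bij (fun x _ => (x.1, x.2)) ?_ ?_ ?_
    · rintro ⟨a, a'⟩ hx
      simp only [mem_sigma, mem_filter, bad, mem_product, A2, N] at hx ⊢
      tauto
    · rintro ⟨a, a'⟩ _ ⟨b, b'⟩ _ h
      simpa using h
    · rintro ⟨a, a'⟩ hx
      simp only [mem_filter, bad, mem_product] at hx
      refine ⟨⟨a, a'⟩, ?_, rfl⟩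
      simp only [mem_sigma, mem_filter, A2, N]
      tauto
  let A' := A2.filter (fun a => q a ≤ A2.card / (8 * K))
  have hA' : M / (6 * K) ≤ A'.card := by
    have h1 : (A2.card : ℝ) / 2 ≤ A'.card := by
      have hc : (A'.card : ℝ) + (A2.filter (fun a => ¬ q a ≤ A2.card / (8 * K))).card = A2.card := by
        exact_mod_cast card_filter_add_card_filter_not _
      have h2 : ((A2.filter (fun a => ¬ q a ≤ A2.card / (8 * K))).card : ℝ) * (A2.card / (8 * K))
          ≤ (A2.card : ℝ) ^ 2 / (16 * K) := by
        refine le_trans ?_ hq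
        refine le_trans ?_ (sum_le_sum_of_subset_of_nonneg (filter_subset
          (fun a => ¬ q a ≤ A2.card / (8 * K)) A2) (fun _ _ _ => by positivity))
        rw [← nsmul_eq_mul]
        exact card_nsmul_le_sum _ _ _ (fun a ha => (not_le.1 (mem_filter.1 ha).2).le)
      have h3 : ((A2.filter (fun a => ¬ q a ≤ A2.card / (8 * K))).card : ℝ) ≤ A2.card / 2 := by
        rw [e2] at h2
        exact le_of_mul_le_mul_right h2 (by positivity)
      linarith
    refine le_trans ?_ h1
    have e : M / (6 * K) = M / (3 * K) / 2 := by ring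
    rw [e]; gcongr
  let B' := B.filter (fun b => (A2.card : ℝ) / (4 * K) ≤ ((A2.filter (fun a => r a b)).card : ℝ))
  have hB' : M / (4 * K) ≤ B'.card := by
    have h1 : (A2.card : ℝ) * (M / (2 * K)) ≤ ∑ a ∈ A2, ((B.filter (fun b => r a b)).card : ℝ) := by
      rw [← nsmul_eq_mul]
      exact card_nsmul_le_sum _ _ _ (fun a ha => (mem_filter.1 (hA2A1 ha)).2)
    rw [sum_card_filter_comm] at h1
    have h2 := sum_le_sum_filter_add B (fun b => ((A2.filter (fun a => r a b)).card : ℝ))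
      ((A2.card : ℝ) / (4 * K)) M (by positivity) hB
    have h3 : ∑ b ∈ B', ((A2.filter (fun a => r a b)).card : ℝ) ≤ B'.card * A2.card := by
      rw [← nsmul_eq_mul]
      exact sum_le_card_nsmul _ _ _ (fun b _ => by exact_mod_cast card_filter_le _ _)
    have e : (A2.card : ℝ) * (M / (2 * K)) = M / (4 * K) * A2.card + A2.card / (4 * K) * M := by
      ring
    refine le_of_mul_le_mul_right (a := (A2.card : ℝ)) ?_ hA2pos
    linarith
  refine ⟨A', (filter_subset _ _).trans (hA2A1.trans hA1A), B', filter_subset _ _, hA', hB', ?_⟩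
  intro a ha b hb
  have ha' := (mem_filter.1 ha).2
  have hb' := (mem_filter.1 hb).2
  -- Middle vertices of the paths: b has at least |A2|/(4K) neighbours in `A2`, and at most
  -- |A2|/(8K) of them have small codegree with a.
  let G := A2.filter (fun a' => r a' b ∧ θ ≤ cod (a, a'))
  have hG : (A2.card : ℝ) / (8 * K) ≤ G.card := by
    have h1 : ((A2.filter (fun a => r a b)).card : ℝ) ≤ G.card + q a := by
      rw [← Nat.cast_add]
      refine Nat.cast_le.2 (le_trans (card_le_card ?_) (card_union_le _ _))
      intro x hx
      simp only [G, mem_union, mem_filter] at hx ⊢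
      by_cases h : θ ≤ cod (a, x)
      · exact Or.inl ⟨hx.1, hx.2, h⟩
      · exact Or.inr ⟨hx.1, not_le.1 h⟩
    have e : (A2.card : ℝ) / (4 * K) = A2.card / (8 * K) + A2.card / (8 * K) := by
      ring
    linarith
  calc M ^ 2 / (2 ^ 12 * K ^ 5) ≤ M / (3 * K) / (8 * K) * θ := by
        rw [hθ]
        have : M / (3 * K) / (8 * K) * (M / (128 * K ^ 3)) = M ^ 2 / (3072 * K ^ 5) := by
          ring
        rw [this]; gcongr; norm_num
    _ ≤ G.card * θ := by
        gcongr
        exact le_trans (by gcongr) hG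
    _ ≤ ∑ a' ∈ G, cod (a, a') := by
        rw [← nsmul_eq_mul]
        exact card_nsmul_le_sum _ _ _ (fun x hx => (mem_filter.1 hx).2.2)
    _ ≤ _ := by
        simp only [cod, ← Nat.cast_sum, ← card_sigma]
        refine Nat.cast_le.2 (card_le_card_of_injOn (fun x => (x.1, x.2)) ?_ ?_)
        · rintro ⟨a', b'⟩ hx
          simp only [mem_coe, mem_sigma, mem_filter, G, mem_product] at hx ⊢
          exact ⟨⟨hA1A (hA2A1 hx.1.1), hx.2.1⟩, hx.2.2.1, hx.2.2.2, hx.1.2.1⟩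
        · rintro ⟨a, a'⟩ _ ⟨b, b'⟩ _ h
          simpa using h

/-- Among many large subsets of a small set, one meets many of the others in a large set. -/
theorem exists_popular_intersection {ι γ : Type*} [DecidableEq γ] (X : Finset ι)
    (hX : X.Nonempty) (S : ι → Finset γ) (Z : Finset γ) (σ z : ℝ) (hσ : 0 < σ) (hz : 0 < z)
    (hZ : (Z.card : ℝ) ≤ z) (hS : ∀ x ∈ X, S x ⊆ Z) (hSσ : ∀ x ∈ X, σ ≤ (S x).card) :
    ∃ x₀ ∈ X, (X.card : ℝ) * σ ^ 2 / (2 * z ^ 2) ≤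
      (X.filter (fun x => σ ^ 2 / (2 * z) ≤ ((S x ∩ S x₀).card : ℝ))).card := by
  have h1 : (X.card : ℝ) * σ ≤ ∑ c ∈ Z, ((X.filter (fun x => c ∈ S x)).card : ℝ) := by
    rw [← sum_card_filter_comm X Z (fun x c => c ∈ S x), ← nsmul_eq_mul]
    refine card_nsmul_le_sum _ _ _ fun x hx => ?_
    rw [filter_mem_eq_inter, inter_eq_right.2 (hS x hx)]
    exact hSσ x hx
  have h2 : (∑ c ∈ Z, ((X.filter (fun x => c ∈ S x)).card : ℝ)) ^ 2
      ≤ Z.card * ∑ c ∈ Z, ((X.filter (fun x => c ∈ S x)).card : ℝ) ^ 2 := sq_sum_le_card_mul_sum_sq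
  have h3 : ∑ c ∈ Z, ((X.filter (fun x => c ∈ S x)).card : ℝ) ^ 2
      = ∑ x₀ ∈ X, ∑ x ∈ X, ((S x ∩ S x₀).card : ℝ) := by
    have := sum_card_filter_comm Z (X ×ˢ X) (fun c y => c ∈ S y.2 ∩ S y.1)
    rw [sum_product] at this
    convert this using 1
    · refine sum_congr rfl fun c _ => ?_
      rw [sq, ← Nat.cast_mul, ← card_product]
      congr 2
      ext ⟨x, y⟩
      simp only [mem_filter, mem_product, mem_inter]
      tauto
    · refine sum_congr rfl fun x hx => sum_congr rfl fun y hy => ?_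
      rw [filter_mem_eq_inter, inter_eq_right.2 (inter_subset_left.trans (hS y hy))]
  -- By `h3` the second moment of the multiplicities is the sum of all pairwise intersections, so
  -- some x₀ attains the average.
  have hXpos : (0 : ℝ) < X.card := by exact_mod_cast hX.card_pos
  have hpos : 0 ≤ ∑ c ∈ Z, ((X.filter (fun x => c ∈ S x)).card : ℝ) ^ 2 :=
    sum_nonneg fun _ _ => sq_nonneg _
  have h4 : ((X.card : ℝ) * σ) ^ 2 ≤ z * ∑ x₀ ∈ X, ∑ x ∈ X, ((S x ∩ S x₀).card : ℝ) := by
    rw [← h3]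
    calc _ ≤ _ := pow_le_pow_left₀ (by positivity) h1 2
      _ ≤ _ := h2
      _ ≤ _ := mul_le_mul_of_nonneg_right hZ hpos
  obtain ⟨x₀, hx₀, h5⟩ : ∃ x₀ ∈ X, (X.card : ℝ) * σ ^ 2 / z ≤
      ∑ x ∈ X, ((S x ∩ S x₀).card : ℝ) := by
    by_contra! hcon
    have := sum_lt_sum_of_nonempty hX hcon
    rw [sum_const, nsmul_eq_mul] at this
    have e : z * ((X.card : ℝ) * ((X.card : ℝ) * σ ^ 2 / z)) = ((X.card : ℝ) * σ) ^ 2 := by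
      field_simp
    have := mul_lt_mul_of_pos_left this hz
    linarith
  refine ⟨x₀, hx₀, ?_⟩
  have h6 := sum_le_sum_filter_add X (fun x => ((S x ∩ S x₀).card : ℝ)) (σ ^ 2 / (2 * z)) X.card
    (by positivity) le_rfl
  set X0 := X.filter (fun x => σ ^ 2 / (2 * z) ≤ ((S x ∩ S x₀).card : ℝ))
  have h7 : ∑ x ∈ X0, ((S x ∩ S x₀).card : ℝ) ≤ X0.card * z := by
    rw [← nsmul_eq_mul]
    refine sum_le_card_nsmul _ _ _ fun x _ => le_trans ?_ hZ
    exact_mod_cast card_le_card (inter_subset_right.trans (hS x₀ hx₀))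
  have e : (X.card : ℝ) * σ ^ 2 / z = (X.card : ℝ) * σ ^ 2 / (2 * z ^ 2) * z
      + σ ^ 2 / (2 * z) * X.card := by field_simp; ring
  refine le_of_mul_le_mul_right (a := z) ?_ hz
  linarith

/-! ### From graphs to sumsets and dilates. -/

variable {F : Type*} [Field F] [DecidableEq F]

/-- A Balog–Szemerédi–Gowers theorem for the form `u + x v`. -/
theorem exists_small_sumset (A B C : Finset F) (x : F) (hx : x ≠ 0) (r : F → F → Prop)
    [∀ a b, Decidable (r a b)] (M K : ℝ) (hM : 0 < M) (hK : 0 < K) (hA : (A.card : ℝ) ≤ M)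
    (hB : (B.card : ℝ) ≤ M) (hC : (C.card : ℝ) ≤ M) (hr : ∀ u ∈ A, ∀ v ∈ B, r u v → u + x * v ∈ C)
    (hE : M ^ 2 / K ≤ ∑ a ∈ A, ((B.filter (fun b => r a b)).card : ℝ)) :
    ∃ A' ⊆ A, ∃ B' ⊆ B, M / (6 * K) ≤ A'.card ∧ M / (6 * K) ≤ B'.card ∧
      ((A' + x • B').card : ℝ) ≤ 2 ^ 12 * K ^ 5 * M := by
  obtain ⟨A', hA', B', hB', h1, h2, h3⟩ := exists_many_paths_three A B r M K hM hK hA hB hE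
  refine ⟨A', hA', B', hB', h1, le_trans ?_ h2, ?_⟩
  · gcongr; norm_num
  have hD : ∀ d ∈ A' + x • B', ∃ a ∈ A', ∃ b ∈ B', a + x * b = d := by
    intro d hd
    obtain ⟨a, ha, b', hb', rfl⟩ := mem_add.1 hd
    obtain ⟨b, hb, rfl⟩ := mem_smul_finset.1 hb'
    exact ⟨a, ha, b, hb, rfl⟩
  choose! f hf g hg hfg using hD
  let Q : F → Finset (F × F) := fun d =>
    (A ×ˢ B).filter (fun y => r (f d) y.2 ∧ r y.1 y.2 ∧ r y.1 (g d))
  -- A path a – b' – a' – b writes a + xb as (a + xb') - (a' + xb') + (a' + xb), with three terms in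
  -- C. The three terms determine the sum and then the path, since one fixed pair (a, b) is chosen
  -- for each sum.
  have h4 : ((A' + x • B').card : ℝ) * (M ^ 2 / (2 ^ 12 * K ^ 5)) ≤ M ^ 3 := by
    calc _ ≤ ∑ d ∈ A' + x • B', ((Q d).card : ℝ) := by
          rw [← nsmul_eq_mul]
          exact card_nsmul_le_sum _ _ _ fun d hd => h3 _ (hf d hd) _ (hg d hd)
      _ = (((A' + x • B').sigma Q).card : ℝ) := by rw [card_sigma]; push_cast; rfl
      _ ≤ ((C ×ˢ C ×ˢ C).card : ℝ) := by
          refine Nat.cast_le.2 (card_le_card_of_injOn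
            (fun y => (f y.1 + x * y.2.2, y.2.1 + x * y.2.2, y.2.1 + x * g y.1)) ?_ ?_)
          · rintro ⟨d, a, b⟩ hy
            simp only [mem_coe, mem_sigma, Q, mem_filter, mem_product] at hy ⊢
            exact ⟨hr _ (hA' (hf d hy.1)) _ hy.2.1.2 hy.2.2.1, hr _ hy.2.1.1 _ hy.2.1.2 hy.2.2.2.1,
              hr _ hy.2.1.1 _ (hB' (hg d hy.1)) hy.2.2.2.2⟩
          · rintro ⟨d, a, b⟩ hy ⟨d', a', b'⟩ hy' h
            simp only [mem_coe, mem_sigma, Q] at hy hy'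
            simp only [Prod.mk.injEq] at h
            obtain ⟨e1, e2, e3⟩ := h
            have e4 : d = d' := by
              rw [← hfg d hy.1, ← hfg d' hy'.1]
              linear_combination e1 - e2 + e3
            subst e4
            have e5 : b = b' := mul_left_cancel₀ hx (add_left_cancel e1)
            have e6 : a = a' := add_right_cancel e3
            subst e5 e6
            rfl
      _ = (C.card : ℝ) * (C.card * C.card) := by simp [card_product]
      _ ≤ M * (M * M) := by gcongr
      _ = _ := by ring
  have e : M ^ 3 = 2 ^ 12 * K ^ 5 * M * (M ^ 2 / (2 ^ 12 * K ^ 5)) := by field_simp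
  rw [e] at h4
  exact le_of_mul_le_mul_right h4 (by positivity)

theorem ruzsa_triangle_real (U V W : Finset F) :
    ((U + W).card : ℝ) * V.card ≤ (U + V).card * (V + W).card := by
  exact_mod_cast ruzsa_triangle_inequality_add_add_add U V W

theorem card_smul_finset_of_ne_zero {x : F} (hx : x ≠ 0) (B : Finset F) :
    (x • B).card = B.card :=
  card_image_of_injective _ (mul_right_injective₀ hx)

/-- If `u + x v` takes few values on a dense subset of `A × B` for each `x ∈ X`, then a large
subset of `A` has few sums with its dilates by the ratios of a large part of `X`. -/
theorem exists_small_dilate_sums (A B X : Finset F) (hX : X.Nonempty) (hX0 : (0 : F) ∉ X)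
    (C : F → Finset F) (r : F → F → F → Prop) [∀ x a b, Decidable (r x a b)] (M K : ℝ)
    (hM : 0 < M) (hK : 0 < K) (hA : (A.card : ℝ) ≤ M) (hB : (B.card : ℝ) ≤ M)
    (hC : ∀ x ∈ X, ((C x).card : ℝ) ≤ M)
    (hr : ∀ x ∈ X, ∀ u ∈ A, ∀ v ∈ B, r x u v → u + x * v ∈ C x)
    (hE : ∀ x ∈ X, M ^ 2 / K ≤ ∑ a ∈ A, ((B.filter (fun b => r x a b)).card : ℝ)) :
    ∃ A₀ ⊆ A, ∃ X₁ : Finset F, (1 : F) ∈ X₁ ∧ (0 : F) ∉ X₁ ∧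
      M / (6 * K) ≤ A₀.card ∧ (X.card : ℝ) / (2 * (6 * K) ^ 4) ≤ X₁.card ∧
      ∀ y ∈ X₁, ((A₀ + y • A₀).card : ℝ) ≤
        2 * (2 ^ 12 * K ^ 5) ^ 6 * (6 * K) ^ 8 * A₀.card := by
  have h := fun x (hx : x ∈ X) => exists_small_sumset A B (C x) x (fun h => hX0 (h ▸ hx)) (r x) M K
    hM hK hA hB (hC x hx) (hr x hx) (hE x hx)
  choose! Ax hAx Bx hBx hAM hBM hs using h
  obtain ⟨b, hb⟩ : ∃ b, b = 6 * K := ⟨_, rfl⟩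
  obtain ⟨s, hs'⟩ : ∃ s, s = 2 ^ 12 * K ^ 5 := ⟨_, rfl⟩
  have hbpos : 0 < b := by rw [hb]; positivity
  have hspos : 0 < s := by rw [hs']; positivity
  rw [← hb, ← hs']
  simp only [← hb, ← hs'] at hAM hBM hs
  have hσz : M ^ 2 / b ^ 2 ≤ M ^ 2 := by
    obtain ⟨x, hx⟩ := hX
    have h1 : M / b ≤ M :=
      (hAM x hx).trans (le_trans (by exact_mod_cast card_le_card (hAx x hx)) hA)
    have := pow_le_pow_left₀ (by positivity) h1 2
    rwa [div_pow] at this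
  obtain ⟨x₀, hx₀, hpop⟩ := exists_popular_intersection X hX (fun x => Ax x ×ˢ Bx x) (A ×ˢ B)
    (M ^ 2 / b ^ 2) (M ^ 2) (by positivity) (by positivity)
    (by rw [card_product, Nat.cast_mul, sq]; gcongr)
    (fun x hx => product_subset_product (hAx x hx) (hBx x hx))
    (fun x hx => by
      rw [card_product, Nat.cast_mul, ← div_pow, sq]
      exact mul_le_mul (hAM x hx) (hBM x hx) (by positivity) (by positivity))
  have e1 : (X.card : ℝ) * (M ^ 2 / b ^ 2) ^ 2 / (2 * (M ^ 2) ^ 2) = X.card / (2 * b ^ 4) := by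
    field_simp
  have e2 : (M ^ 2 / b ^ 2) ^ 2 / (2 * M ^ 2) = M ^ 2 / (2 * b ^ 4) := by
    field_simp
  rw [e1, e2] at hpop
  have hx₀0 : x₀ ≠ 0 := fun h => hX0 (h ▸ hx₀)
  set X0 := X.filter (fun x => M ^ 2 / (2 * b ^ 4) ≤
    (((Ax x ×ˢ Bx x) ∩ (Ax x₀ ×ˢ Bx x₀)).card : ℝ)) with hX0def
  -- This membership puts 1 = x₀/x₀ into the set of ratios.
  have hx₀X0 : x₀ ∈ X0 := by
    refine mem_filter.2 ⟨hx₀, ?_⟩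
    rw [inter_self, card_product, Nat.cast_mul]
    calc M ^ 2 / (2 * b ^ 4) = (M ^ 2 / b ^ 2) ^ 2 / (2 * M ^ 2) := e2.symm
      _ ≤ (M ^ 2 / b ^ 2) * M ^ 2 / (2 * M ^ 2) := by
          rw [sq (M ^ 2 / b ^ 2)]
          exact div_le_div_of_nonneg_right
            (mul_le_mul_of_nonneg_left hσz (by positivity)) (by positivity)
      _ = (M / b * (M / b)) / 2 := by field_simp
      _ ≤ M / b * (M / b) := half_le_self (by positivity)
      _ ≤ _ := mul_le_mul (hAM x₀ hx₀) (hBM x₀ hx₀) (by positivity) (by positivity)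
  refine ⟨Ax x₀, hAx x₀ hx₀, X0.image (fun x => x / x₀), ?_, ?_, hAM x₀ hx₀, ?_, ?_⟩
  · exact mem_image.2 ⟨x₀, hx₀X0, div_self hx₀0⟩
  · intro h
    obtain ⟨x, hx, h⟩ := mem_image.1 h
    rcases div_eq_zero_iff.1 h with h | h
    · exact hX0 (h ▸ (mem_filter.1 hx).1)
    · exact hx₀0 h
  · rwa [card_image_of_injective]
    intro x y hxy
    exact (div_left_inj' hx₀0).1 hxy
  · intro y hy
    obtain ⟨x, hx, rfl⟩ := mem_image.1 hy
    obtain ⟨hxX, hxM⟩ := mem_filter.1 hx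
    have hx0 : x ≠ 0 := fun h => hX0 (h ▸ hxX)
    rw [product_inter_product, card_product, Nat.cast_mul] at hxM
    have hsx := hs x hxX
    have hs0 := hs x₀ hx₀
    have ha0 := hAM x₀ hx₀
    have hb0 := hBM x₀ hx₀
    have hsubA : Ax x ∩ Ax x₀ ⊆ Ax x := inter_subset_left
    have hsubB : Bx x ∩ Bx x₀ ⊆ Bx x := inter_subset_left
    have hsubA' : Ax x ∩ Ax x₀ ⊆ Ax x₀ := inter_subset_right
    have hsubB' : Bx x ∩ Bx x₀ ⊆ Bx x₀ := inter_subset_right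
    generalize Ax x ∩ Ax x₀ = A1 at *
    generalize Bx x ∩ Bx x₀ = B1 at *
    generalize Ax x₀ = A0 at *
    generalize Bx x₀ = B0 at *
    have cardle : ∀ {U V : Finset F}, U ⊆ V → (U.card : ℝ) ≤ V.card :=
      fun h => by exact_mod_cast card_le_card h
    have cb0 : ((x₀ • B0).card : ℝ) = B0.card := by rw [card_smul_finset_of_ne_zero hx₀0]
    have cbx0 : ((x • B0).card : ℝ) = B0.card := by rw [card_smul_finset_of_ne_zero hx0]
    have cb1 : ((x • B1).card : ℝ) = B1.card := by rw [card_smul_finset_of_ne_zero hx0]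
    -- A chain of Ruzsa triangles: A0 + A0 through x₀B0, xB0 + xB0 through A0, A1 + xB0 through xB1,
    -- A0 + xB0 through A1, and finally A0 + (x/x₀)A0 through xB0.
    have t1 : ((A0 + A0).card : ℝ) ≤ s ^ 2 * b * M := by
      have h := ruzsa_triangle_real A0 (x₀ • B0) A0
      rw [cb0, add_comm (x₀ • B0) A0] at h
      have h2 : ((A0 + x₀ • B0).card : ℝ) * (A0 + x₀ • B0).card ≤ s * M * (s * M) :=
        mul_le_mul hs0 hs0 (by positivity) (by positivity)
      have h3 : ((A0 + A0).card : ℝ) * (M / b) ≤ (A0 + A0).card * B0.card :=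
        mul_le_mul_of_nonneg_left hb0 (by positivity)
      have e : s * M * (s * M) = s ^ 2 * b * M * (M / b) := by field_simp
      exact le_of_mul_le_mul_right (by linarith) (by positivity : 0 < M / b)
    have t2 : ((x • B0 + x • B0).card : ℝ) ≤ s ^ 2 * b * M := by
      have h := ruzsa_triangle_real (x₀ • B0) A0 (x₀ • B0)
      rw [add_comm (x₀ • B0) A0] at h
      have h2 : ((A0 + x₀ • B0).card : ℝ) * (A0 + x₀ • B0).card ≤ s * M * (s * M) :=
        mul_le_mul hs0 hs0 (by positivity) (by positivity)
      have e0 : (x • B0 + x • B0).card = (x₀ • B0 + x₀ • B0).card := by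
        rw [← smul_add, ← smul_add, card_smul_finset_of_ne_zero hx0,
          card_smul_finset_of_ne_zero hx₀0]
      have h3 : ((x₀ • B0 + x₀ • B0).card : ℝ) * (M / b) ≤ (x₀ • B0 + x₀ • B0).card * A0.card :=
        mul_le_mul_of_nonneg_left ha0 (by positivity)
      have e : s * M * (s * M) = s ^ 2 * b * M * (M / b) := by field_simp
      rw [e0]
      exact le_of_mul_le_mul_right (by linarith) (by positivity : 0 < M / b)
    have t3 : ((A1 + x • B0).card : ℝ) * B1.card ≤ s * M * (s ^ 2 * b * M) := by
      have h := ruzsa_triangle_real A1 (x • B1) (x • B0)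
      rw [cb1] at h
      refine h.trans (mul_le_mul ?_ ?_ (by positivity) (by positivity))
      · exact (cardle (add_subset_add hsubA (smul_finset_subset_smul_finset hsubB))).trans hsx
      · exact (cardle (add_subset_add_right (smul_finset_subset_smul_finset hsubB'))).trans t2
    have t4 : ((A0 + x • B0).card : ℝ) ≤ 2 * s ^ 5 * b ^ 6 * M := by
      have h := ruzsa_triangle_real A0 A1 (x • B0)
      have h1 : ((A0 + A1).card : ℝ) ≤ s ^ 2 * b * M := (cardle (add_subset_add_left hsubA')).trans t1
      have h2 : ((A0 + x • B0).card : ℝ) * (A1.card * B1.card) ≤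
          s ^ 2 * b * M * (s * M * (s ^ 2 * b * M)) := by
        calc _ = ((A0 + x • B0).card : ℝ) * A1.card * B1.card := by ring
          _ ≤ (A0 + A1).card * (A1 + x • B0).card * B1.card :=
              mul_le_mul_of_nonneg_right h (by positivity)
          _ = (A0 + A1).card * ((A1 + x • B0).card * B1.card) := by ring
          _ ≤ _ := mul_le_mul h1 t3 (by positivity) (by positivity)
      have h3 : ((A0 + x • B0).card : ℝ) * (M ^ 2 / (2 * b ^ 4)) ≤
          (A0 + x • B0).card * (A1.card * B1.card) := mul_le_mul_of_nonneg_left hxM (by positivity)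
      have e : s ^ 2 * b * M * (s * M * (s ^ 2 * b * M)) =
          2 * s ^ 5 * b ^ 6 * M * (M ^ 2 / (2 * b ^ 4)) := by field_simp
      exact le_of_mul_le_mul_right (by linarith) (by positivity : 0 < M ^ 2 / (2 * b ^ 4))
    have t5 : ((A0 + (x / x₀) • A0).card : ℝ) * B0.card ≤ 2 * s ^ 5 * b ^ 6 * M * (s * M) := by
      have h := ruzsa_triangle_real A0 (x • B0) ((x / x₀) • A0)
      rw [cbx0] at h
      have e : x • B0 + (x / x₀) • A0 = (x / x₀) • (A0 + x₀ • B0) := by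
        rw [smul_add, smul_smul, div_mul_cancel₀ _ hx₀0, add_comm]
      rw [e, card_smul_finset_of_ne_zero (div_ne_zero hx0 hx₀0)] at h
      exact h.trans (mul_le_mul t4 hs0 (by positivity) (by positivity))
    have h3 : ((A0 + (x / x₀) • A0).card : ℝ) * (M / b) ≤ (A0 + (x / x₀) • A0).card * B0.card :=
      mul_le_mul_of_nonneg_left hb0 (by positivity)
    have e : 2 * s ^ 5 * b ^ 6 * M * (s * M) = 2 * s ^ 6 * b ^ 7 * M * (M / b) := by field_simp
    have t6 : ((A0 + (x / x₀) • A0).card : ℝ) ≤ 2 * s ^ 6 * b ^ 7 * M :=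
      le_of_mul_le_mul_right (by linarith) (by positivity : 0 < M / b)
    calc _ ≤ _ := t6
      _ = 2 * s ^ 6 * b ^ 8 * (M / b) := by field_simp
      _ ≤ _ := mul_le_mul_of_nonneg_left ha0 (by positivity)

/-! ### Additive energy of dilates and the pivot argument for subfields. -/

section Pivot
variable {F : Type*} [Field F] [DecidableEq F]

/-- The number of solutions of `a₁ + η a₂ = a₃ + η a₄` in `A`. -/
def dilateEnergy (A : Finset F) (η : F) : ℕ :=
  (((A ×ˢ A) ×ˢ (A ×ˢ A)).filter (fun q => q.1.1 + η * q.1.2 = q.2.1 + η * q.2.2)).card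

theorem card_pow_four_le_mul_dilateEnergy (A : Finset F) (η : F) :
    (A.card : ℝ) ^ 4 ≤ (A + η • A).card * dilateEnergy A η := by
  have h := card_sq_le_card_mul_collisions (A ×ˢ A) (A + η • A) (fun y => y.1 + η * y.2)
    (fun y hy => add_mem_add (mem_product.1 hy).1
      (mem_smul_finset.2 ⟨_, (mem_product.1 hy).2, rfl⟩))
  rw [card_product, Nat.cast_mul] at h
  calc (A.card : ℝ) ^ 4 = ((A.card : ℝ) * A.card) ^ 2 := by ring
    _ ≤ _ := h

open Classical in
-- A quadruple with a₂ ≠ a₄ determines η, so it is counted once. If a₂ = a₄ then a₁ = a₃, which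
-- leaves |A|² choices for each η.
theorem sum_dilateEnergy_le (A Y : Finset F) :
    ∑ η ∈ Y, (dilateEnergy A η : ℝ) ≤
      (((A ×ˢ A) ×ˢ (A ×ˢ A)).filter (fun q => q.1.2 ≠ q.2.2 ∧
        ∃ η ∈ Y, q.1.1 + η * q.1.2 = q.2.1 + η * q.2.2)).card + (A.card : ℝ) ^ 2 * Y.card := by
  simp only [dilateEnergy, ← Nat.cast_sum, ← card_sigma]
  rw [← Nat.cast_pow, ← Nat.cast_mul, ← Nat.cast_add, Nat.cast_le]
  rw [sq, ← card_product, ← card_product]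
  set T := ((A ×ˢ A) ×ˢ (A ×ˢ A)).filter (fun q => q.1.2 ≠ q.2.2 ∧
        ∃ η ∈ Y, q.1.1 + η * q.1.2 = q.2.1 + η * q.2.2)
  set U := (A ×ˢ A) ×ˢ Y
  rw [← card_disjSum]
  refine card_le_card_of_injOn
    (fun x => if x.2.1.2 ≠ x.2.2.2 then Sum.inl x.2 else Sum.inr (x.2.1, x.1)) ?_ ?_
  · rintro ⟨η, ⟨a1, a2⟩, ⟨a3, a4⟩⟩ hx
    simp only [mem_coe, mem_sigma, mem_filter, mem_product] at hx
    dsimp only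
    split_ifs with h
    · simp only [T, mem_coe, inl_mem_disjSum, mem_filter, mem_product]
      exact ⟨hx.2.1, h, η, hx.1, hx.2.2⟩
    · simp only [U, mem_coe, inr_mem_disjSum, mem_product]
      exact ⟨hx.2.1.1, hx.1⟩
  · rintro ⟨η, ⟨a1, a2⟩, ⟨a3, a4⟩⟩ hx ⟨ξ, ⟨b1, b2⟩, ⟨b3, b4⟩⟩ hy h
    simp only [mem_coe, mem_sigma, mem_filter, mem_product] at hx hy
    dsimp only at h
    split_ifs at h with h1 h2 h2
    · simp only [Sum.inl.injEq, Prod.mk.injEq] at h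
      obtain ⟨⟨rfl, rfl⟩, rfl, rfl⟩ := h
      have : (η - ξ) * (a2 - a4) = 0 := by linear_combination hx.2.2 - hy.2.2
      rcases mul_eq_zero.1 this with h | h
      · rw [sub_eq_zero.1 h]
      · exact absurd (sub_eq_zero.1 h) h1
    · simp only [Sum.inr.injEq, Prod.mk.injEq] at h
      obtain ⟨⟨rfl, rfl⟩, rfl⟩ := h
      simp only [ne_eq, not_not] at h1 h2
      subst h1 h2
      have e1 := add_right_cancel hx.2.2
      have e2 := add_right_cancel hy.2.2
      subst e1 e2
      rfl

theorem sum_dilateEnergy_le' (A Y : Finset F) :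
    ∑ η ∈ Y, (dilateEnergy A η : ℝ) ≤ (A.card : ℝ) ^ 4 + (A.card : ℝ) ^ 2 * Y.card := by
  classical
  refine (sum_dilateEnergy_le A Y).trans ?_
  have : (A.card : ℝ) ^ 4 = (((A ×ˢ A) ×ˢ (A ×ˢ A)).card : ℝ) := by
    simp only [card_product, Nat.cast_mul]; ring
  rw [this]
  gcongr
  exact filter_subset _ _

/-- A set of dilates with which `A` has few sums is small. -/
theorem card_le_of_small_dilate_sums (A Y : Finset F) (Q : ℝ) (hQ : 0 < Q)
    (hA : 2 * Q ≤ A.card) (h : ∀ η ∈ Y, ((A + η • A).card : ℝ) ≤ Q * A.card) :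
    (Y.card : ℝ) ≤ 2 * Q * A.card := by
  have ha : (0 : ℝ) < A.card := by linarith
  -- Each η has energy at least |A|³/Q by Cauchy–Schwarz, while the total is at most |A|⁴ + |A|²|Y|.
  -- The assumption |A| ≥ 2Q lets the second term be absorbed.
  have h1 : (Y.card : ℝ) * ((A.card : ℝ) ^ 3 / Q) ≤ ∑ η ∈ Y, (dilateEnergy A η : ℝ) := by
    rw [← nsmul_eq_mul]
    refine card_nsmul_le_sum _ _ _ fun η hη => ?_
    rw [div_le_iff₀ hQ]
    have h2 := card_pow_four_le_mul_dilateEnergy A η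
    have h3 : ((A + η • A).card : ℝ) * dilateEnergy A η ≤ Q * A.card * dilateEnergy A η :=
      mul_le_mul_of_nonneg_right (h η hη) (by positivity)
    refine le_of_mul_le_mul_left (a := (A.card : ℝ)) ?_ ha
    calc (A.card : ℝ) * (A.card : ℝ) ^ 3 = (A.card : ℝ) ^ 4 := by ring
      _ ≤ _ := h2.trans h3
      _ = _ := by ring
  have h2 := h1.trans (sum_dilateEnergy_le' A Y)
  have h3 : (Y.card : ℝ) * (A.card : ℝ) ^ 2 ≤ Y.card * ((A.card : ℝ) ^ 3 / Q) / 2 := by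
    have : (A.card : ℝ) ^ 2 ≤ (A.card : ℝ) ^ 3 / Q / 2 := by
      rw [le_div_iff₀ (by norm_num), le_div_iff₀ hQ]
      nlinarith [mul_le_mul_of_nonneg_left hA (sq_nonneg (A.card : ℝ))]
    calc _ ≤ (Y.card : ℝ) * ((A.card : ℝ) ^ 3 / Q / 2) := by gcongr
      _ = _ := by ring
  have h4 : (Y.card : ℝ) * ((A.card : ℝ) ^ 3 / Q) / 2 ≤ (A.card : ℝ) ^ 4 := by linarith
  have e : (A.card : ℝ) ^ 4 = 2 * Q * A.card * ((A.card : ℝ) ^ 3 / Q) / 2 := by field_simp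
  rw [e] at h4
  exact le_of_mul_le_mul_right (a := (A.card : ℝ) ^ 3 / Q) (by linarith) (by positivity)

/-- The Plünnecke–Ruzsa inequality, moved to the reals and with the doubling ratio replaced by an
upper bound. -/
theorem card_sub_nsmul_le (A C : Finset F) (hA : A.Nonempty) (k : ℝ)
    (h : ((A + C).card : ℝ) ≤ k * A.card) (m n : ℕ) :
    ((m • C - n • C).card : ℝ) ≤ k ^ (m + n) * A.card := by
  have h1 := pluennecke_ruzsa_inequality_nsmul_sub_nsmul_add hA C m n
  have h2 : ((m • C - n • C).card : ℝ) ≤ (((A + C).card : ℝ) / A.card) ^ (m + n) * A.card := by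
    have h3 : (((m • C - n • C).card : ℚ≥0) : ℝ) ≤
        (((((A + C).card : ℚ≥0) / A.card) ^ (m + n) * A.card : ℚ≥0) : ℝ) := by exact_mod_cast h1
    push_cast at h3
    exact h3
  have ha : (0 : ℝ) < A.card := by exact_mod_cast hA.card_pos
  refine h2.trans ?_
  gcongr
  rwa [div_le_iff₀ ha]

theorem card_add_dilates_le (A S : Finset F) (T : ℝ)
    (h : ∀ m ∈ S, ((A + m • A).card : ℝ) ≤ T * A.card) :
    ((A + S • A).card : ℝ) ≤ S.card * T * A.card := by
  have e : A + S • A ⊆ S.biUnion (fun m => A + m • A) := by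
    intro y hy
    obtain ⟨a, ha, z, hz, rfl⟩ := mem_add.1 hy
    obtain ⟨m, hm, b, hb, rfl⟩ := mem_smul.1 hz
    exact mem_biUnion.2 ⟨m, hm, add_mem_add ha (smul_mem_smul_finset hb)⟩
  calc ((A + S • A).card : ℝ) ≤ ((S.biUnion (fun m => A + m • A)).card : ℝ) := by
        exact_mod_cast card_le_card e
    _ ≤ ∑ m ∈ S, ((A + m • A).card : ℝ) := by exact_mod_cast card_biUnion_le
    _ ≤ S.card • (T * A.card) := sum_le_card_nsmul _ _ _ h
    _ = _ := by rw [nsmul_eq_mul, mul_assoc]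

/-- Ruzsa's triangle inequality through xA, because xA + xyA is a dilate of A + yA. Good multipliers
may thus be multiplied. -/
theorem card_add_mul_smul_le (A : Finset F) (x y : F) (hx : x ≠ 0) (K T : ℝ) (hK : 0 ≤ K)
    (hA : A.Nonempty)
    (h1 : ((A + x • A).card : ℝ) ≤ K * A.card) (h2 : ((A + y • A).card : ℝ) ≤ T * A.card) :
    ((A + (x * y) • A).card : ℝ) ≤ K * T * A.card := by
  have h := ruzsa_triangle_real A (x • A) ((x * y) • A)
  have e : x • A + (x * y) • A = x • (A + y • A) := by rw [smul_add, smul_smul]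
  rw [e, card_smul_finset_of_ne_zero hx, card_smul_finset_of_ne_zero hx] at h
  have ha : (0 : ℝ) < A.card := by exact_mod_cast hA.card_pos
  refine le_of_mul_le_mul_right (h.trans ?_) ha
  calc _ ≤ (K * A.card) * (T * A.card) := mul_le_mul h1 h2 (by positivity) (by positivity)
    _ = _ := by ring

/-- The set of quotients of differences of elements of `X`. -/
def ratioSet (X : Finset F) : Set F :=
  {ξ | ∃ a ∈ X, ∃ b ∈ X, ∃ c ∈ X, ∃ d ∈ X, c ≠ d ∧ ξ = (a - b) / (c - d)}

variable {A X : Finset F} {K : ℝ}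

theorem card_le_pow_three (hA : A.Nonempty) (hX0 : (0 : F) ∉ X)
    (hK : 1 ≤ K) (h : ∀ x ∈ X, ((A + x • A).card : ℝ) ≤ K * A.card)
    {x y z : F} (hx : x ∈ X) (hy : y ∈ X) (hz : z ∈ X) :
    ((A + (x * (y * z)) • A).card : ℝ) ≤ K ^ 3 * A.card := by
  have ne : ∀ x ∈ X, x ≠ 0 := fun x hx h => hX0 (h ▸ hx)
  have := card_add_mul_smul_le A x (y * z) (ne x hx) K (K * K) (by linarith) hA (h x hx)
    (card_add_mul_smul_le A y z (ne y hy) K K (by linarith) hA (h y hy) (h z hz))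
  calc _ ≤ _ := this
    _ = _ := by ring

/-- The multiplier expands into a signed sum of monomials of degree at most three in X, each of
which is good. Plünnecke–Ruzsa applied to A and S • A, with S the set of these monomials and 1,
handles the sum. -/
theorem card_add_smul_le_of_mul_ratio (hA : A.Nonempty) (hX0 : (0 : F) ∉ X) (hX1 : (1 : F) ∈ X)
    (hK : 1 ≤ K) (h : ∀ x ∈ X, ((A + x • A).card : ℝ) ≤ K * A.card)
    {a b c d z x y : F} (ha : a ∈ X) (hb : b ∈ X) (hc : c ∈ X) (hd : d ∈ X) (hz : z ∈ X)
    (hx : x ∈ X) (hy : y ∈ X) :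
    ((A + ((c - d) * x + z * (a - b) * y) • A).card : ℝ) ≤ 7 ^ 7 * K ^ 15 * A.card := by
  set S : Finset F := {1 * (1 * 1), 1 * (c * x), 1 * (d * x), z * (a * y), z * (b * y)} with hS
  have hS5 : S.card ≤ 5 := card_le_five
  have hSK : ∀ m ∈ S, ((A + m • A).card : ℝ) ≤ K ^ 3 * A.card := by
    intro m hm
    simp only [hS, mem_insert, mem_singleton] at hm
    rcases hm with rfl | rfl | rfl | rfl | rfl <;>
      exact card_le_pow_three hA hX0 hK h (by assumption) (by assumption) (by assumption)
  have h1 := card_sub_nsmul_le A (S • A) hA (S.card * K ^ 3) (card_add_dilates_le A S _ hSK) 3 2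
  have hsub : A + ((c - d) * x + z * (a - b) * y) • A ⊆ 3 • (S • A) - 2 • (S • A) := by
    intro w hw
    obtain ⟨u, hu, w', hw', rfl⟩ := mem_add.1 hw
    obtain ⟨v, hv, rfl⟩ := mem_smul_finset.1 hw'
    have hmem : ∀ m ∈ S, ∀ v ∈ A, m * v ∈ S • A := fun m hm v hv => smul_mem_smul hm hv
    have e : u + ((c - d) * x + z * (a - b) * y) • v =
      (1 * (1 * 1) * u + 1 * (c * x) * v + z * (a * y) * v) -
        (1 * (d * x) * v + z * (b * y) * v) := by
      rw [smul_eq_mul]; ring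
    rw [e, succ_nsmul, two_nsmul]
    refine sub_mem_sub (add_mem_add (add_mem_add ?_ ?_) ?_) (add_mem_add ?_ ?_) <;>
      exact hmem _ (by simp [hS]) _ (by assumption)
  have hK0 : 0 ≤ K := by linarith
  calc _ ≤ ((3 • (S • A) - 2 • (S • A)).card : ℝ) := by exact_mod_cast card_le_card hsub
    _ ≤ _ := h1
    -- The 5 monomials are rounded up to 7 so that both kinds of multiplier obey the same bound
    -- 7⁷K¹⁵.
    _ ≤ (7 * K ^ 3) ^ 5 * A.card := by
        gcongr
        exact le_trans (by exact_mod_cast hS5) (by norm_num : ((5 : ℕ) : ℝ) ≤ 7)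
    _ = 7 ^ 5 * K ^ 15 * A.card := by ring
    _ ≤ _ := by gcongr <;> norm_num

theorem card_add_smul_le_of_one_add_ratio (hA : A.Nonempty) (hX0 : (0 : F) ∉ X)
    (hX1 : (1 : F) ∈ X)
    (hK : 1 ≤ K) (h : ∀ x ∈ X, ((A + x • A).card : ℝ) ≤ K * A.card)
    {a b c d x y : F} (ha : a ∈ X) (hb : b ∈ X) (hc : c ∈ X) (hd : d ∈ X)
    (hx : x ∈ X) (hy : y ∈ X) :
    ((A + ((c - d) * x + ((c - d) + (a - b)) * y) • A).card : ℝ) ≤ 7 ^ 7 * K ^ 15 * A.card := by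
  have ne : ∀ x ∈ X, x ≠ 0 := fun x hx h => hX0 (h ▸ hx)
  set S : Finset F := {1 * 1, c * x, d * x, c * y, d * y, a * y, b * y} with hS
  have hS7 : S.card ≤ 7 := by
    rw [hS]
    exact (card_insert_le _ _).trans (Nat.succ_le_succ card_le_six)
  have hSK : ∀ m ∈ S, ((A + m • A).card : ℝ) ≤ K * K * A.card := by
    intro m hm
    simp only [hS, mem_insert, mem_singleton] at hm
    rcases hm with rfl | rfl | rfl | rfl | rfl | rfl | rfl <;>
      exact card_add_mul_smul_le A _ _ (ne _ (by assumption)) K K (by linarith) hA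
        (h _ (by assumption)) (h _ (by assumption))
  have h1 := card_sub_nsmul_le A (S • A) hA (S.card * (K * K)) (card_add_dilates_le A S _ hSK) 4 3
  have hsub : A + ((c - d) * x + ((c - d) + (a - b)) * y) • A ⊆ 4 • (S • A) - 3 • (S • A) := by
    intro w hw
    obtain ⟨u, hu, w', hw', rfl⟩ := mem_add.1 hw
    obtain ⟨v, hv, rfl⟩ := mem_smul_finset.1 hw'
    have hmem : ∀ m ∈ S, ∀ v ∈ A, m * v ∈ S • A := fun m hm v hv => smul_mem_smul hm hv
    have e : u + ((c - d) * x + ((c - d) + (a - b)) * y) • v =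
      (1 * 1 * u + c * x * v + c * y * v + a * y * v) -
        (d * x * v + d * y * v + b * y * v) := by
      rw [smul_eq_mul]; ring
    rw [e, succ_nsmul, succ_nsmul, two_nsmul]
    refine sub_mem_sub (add_mem_add (add_mem_add (add_mem_add ?_ ?_) ?_) ?_)
      (add_mem_add (add_mem_add ?_ ?_) ?_) <;>
      exact hmem _ (by simp [hS]) _ (by assumption)
  have hK0 : 0 ≤ K := by linarith
  calc _ ≤ ((4 • (S • A) - 3 • (S • A)).card : ℝ) := by exact_mod_cast card_le_card hsub
    _ ≤ _ := h1
    _ ≤ (7 * (K * K)) ^ 7 * A.card := by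
        gcongr
        exact_mod_cast hS7
    _ = 7 ^ 7 * K ^ 14 * A.card := by ring
    _ ≤ _ := by gcongr; norm_num

/-- A subsemiring of a finite field, as a subfield. -/
def Subsemiring.toSubfieldOfFinite [Finite F] (S : Subsemiring F) : Subfield F where
  __ := S
  neg_mem' := by
    intro x hx
    have := Fintype.ofFinite F
    have e : -x = (Fintype.card F - 1) • x := by
      rw [nsmul_eq_mul, Nat.cast_sub Fintype.card_pos, FiniteField.cast_card_eq_zero]
      simp
    rw [e]
    exact nsmul_mem (show x ∈ S from hx) _
  inv_mem' := by
    intro x hx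
    have := Fintype.ofFinite F
    by_cases h0 : x = 0
    · subst h0; rw [inv_zero]; exact hx
    have e : x⁻¹ = x ^ (Fintype.card F - 2) := by
      refine inv_eq_of_mul_eq_one_right ?_
      rw [← pow_succ', show Fintype.card F - 2 + 1 = Fintype.card F - 1 from by
        have := Fintype.one_lt_card (α := F); omega]
      exact FiniteField.pow_card_sub_one_eq_one x h0
    rw [e]
    exact pow_mem (show x ∈ S from hx) _

/-- If the ratio set of `X ∋ 1` is stable under `ξ ↦ 1 + ξ` and under multiplication by `X`, it
contains the subfield generated by `X`. -/
theorem subset_ratioSet_of_stable [Finite F] (hX0 : (0 : F) ∉ X) {u v : F} (hu : u ∈ X)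
    (hv : v ∈ X) (huv : u ≠ v)
    (h1 : ∀ ξ ∈ ratioSet X, 1 + ξ ∈ ratioSet X)
    (h2 : ∀ ξ ∈ ratioSet X, ∀ z ∈ X, z * ξ ∈ ratioSet X) :
    ∃ R : Subfield F, (∀ x ∈ X, x ∈ R) ∧ ∀ ξ ∈ R, ξ ∈ ratioSet X := by
  have hzero : (0 : F) ∈ ratioSet X := ⟨u, hu, u, hu, u, hu, v, hv, huv, by simp⟩
  have hinv : ∀ ξ ∈ ratioSet X, ξ⁻¹ ∈ ratioSet X := by
    rintro ξ ⟨a, ha, b, hb, c, hc, d, hd, hcd, rfl⟩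
    by_cases hab : a = b
    · subst hab; simpa using hzero
    · exact ⟨c, hc, d, hd, a, ha, b, hb, hab, inv_div _ _⟩
  have hm : ∀ m ∈ Submonoid.closure (X : Set F), m ≠ 0 ∧ ∀ ξ ∈ ratioSet X, m * ξ ∈ ratioSet X := by
    intro m hm
    induction hm using Submonoid.closure_induction with
    | mem x hx => exact ⟨fun h => hX0 (h ▸ hx), fun ξ hξ => h2 ξ hξ x hx⟩
    | one => exact ⟨one_ne_zero, fun ξ hξ => by simpa using hξ⟩
    | mul x y _ _ hx hy =>
      refine ⟨mul_ne_zero hx.1 hy.1, fun ξ hξ => ?_⟩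
      rw [mul_assoc]
      exact hx.2 _ (hy.2 _ hξ)
  have hs : ∀ y ∈ AddSubmonoid.closure (Submonoid.closure (X : Set F) : Set F),
      ∀ ξ ∈ ratioSet X, y + ξ ∈ ratioSet X := by
    intro y hy
    induction hy using AddSubmonoid.closure_induction with
    | mem m hmem =>
      intro ξ hξ
      obtain ⟨m0, hmul⟩ := hm m hmem
      -- Ratios are closed under inversion, so multiplication by m⁻¹ is also available and m + ξ =
      -- m(1 + m⁻¹ξ). The convention 0⁻¹ = 0 covers ξ = 0.
      have e : m + ξ = m * (1 + (m * ξ⁻¹)⁻¹) := by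
        rw [mul_inv, inv_inv, mul_add, mul_one, mul_inv_cancel_left₀ m0]
      rw [e]
      exact hmul _ (h1 _ (hinv _ (hmul _ (hinv _ hξ))))
    | zero => intro ξ hξ; simpa using hξ
    | add x y _ _ hx hy =>
      intro ξ hξ
      rw [add_assoc]
      exact hx _ (hy _ hξ)
  refine ⟨(Subsemiring.closure (X : Set F)).toSubfieldOfFinite, fun x hx => ?_, fun ξ hξ => ?_⟩
  · exact Subsemiring.subset_closure (mem_coe.2 hx)
  · have : ξ ∈ Subsemiring.closure (X : Set F) := hξ
    rw [← SetLike.mem_coe, Subsemiring.coe_closure_eq] at this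
    simpa using hs ξ this 0 hzero

/-- A collision of (x, y) ↦ x + ξy on X × X would write ξ as a quotient of differences; hence the
map is injective. -/
theorem card_sq_le_of_notMem_ratioSet (n e ξ : F) (he : e ≠ 0) (hξ : ξ = n / e)
    (hn : ξ ∉ ratioSet X) (Y : Finset F) (hY : ∀ x ∈ X, ∀ y ∈ X, e * x + n * y ∈ Y) :
    X.card ^ 2 ≤ Y.card := by
  rw [sq, ← card_product]
  refine card_le_card_of_injOn (fun y => e * y.1 + n * y.2) ?_ ?_
  · rintro ⟨x, y⟩ h
    rw [mem_coe, mem_product] at h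
    exact hY x h.1 y h.2
  · rintro ⟨x, y⟩ h ⟨x', y'⟩ h' heq
    rw [mem_coe, mem_product] at h h'
    dsimp only at heq h h'
    by_cases hy : y' = y
    · subst hy
      have := mul_left_cancel₀ he (add_right_cancel heq)
      rw [this]
    · refine absurd ⟨x, h.1, x', h'.1, y', h'.2, y, h.2, hy, ?_⟩ hn
      rw [hξ, div_eq_div_iff he (sub_ne_zero.2 hy)]
      linear_combination -heq

/-- The pivot argument: if `A` has few sums with its dilates by the elements of `X`, then `X` is
small or it lies in a small subfield. -/
theorem card_sq_le_or_exists_subfield [Finite F] (hX0 : (0 : F) ∉ X) (hX1 : (1 : F) ∈ X)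
    (hK : 1 ≤ K) (h : ∀ x ∈ X, ((A + x • A).card : ℝ) ≤ K * A.card)
    (hAK : 2 * (7 ^ 7 * K ^ 15) ≤ A.card) :
    (X.card : ℝ) ^ 2 ≤ 4 * (7 ^ 7 * K ^ 15) * A.card ∨
      ∃ R : Subfield F, (∀ x ∈ X, x ∈ R) ∧ (Nat.card R : ℝ) ≤ 4 * (7 ^ 7 * K ^ 15) * A.card := by
  obtain ⟨Q, hQ⟩ : ∃ Q : ℝ, Q = 7 ^ 7 * K ^ 15 := ⟨_, rfl⟩
  have hQ1 : 1 ≤ Q := by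
    rw [hQ]
    have : 1 ≤ K ^ 15 := one_le_pow₀ hK
    linarith
  have hQ0 : 0 < Q := by linarith
  have hA : A.Nonempty := by
    rw [← card_pos]
    have : (0 : ℝ) < A.card := by rw [← hQ] at hAK; linarith
    exact_mod_cast this
  have ha : (1 : ℝ) ≤ A.card := by exact_mod_cast hA.card_pos
  have hmul := @card_add_smul_le_of_mul_ratio F _ _ A X K hA hX0 hX1 hK h
  have hadd := @card_add_smul_le_of_one_add_ratio F _ _ A X K hA hX0 hX1 hK h
  rw [← hQ] at hAK hmul hadd ⊢
  have hY := fun Y => card_le_of_small_dilate_sums A Y Q hQ0 hAK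
  -- If stability fails, the element that escapes the ratio set yields |X|² distinct multipliers,
  -- all of them good for A.
  have big : ∀ (n e ξ : F), e ≠ 0 → ξ = n / e → ξ ∉ ratioSet X →
      (∀ x ∈ X, ∀ y ∈ X, ((A + (e * x + n * y) • A).card : ℝ) ≤ Q * A.card) →
      (X.card : ℝ) ^ 2 ≤ 4 * Q * A.card := by
    intro n e ξ he hξ hn hb
    have h1 := card_sq_le_of_notMem_ratioSet n e ξ he hξ hn
      ((X ×ˢ X).image (fun y => e * y.1 + n * y.2))
      (fun x hx y hy => mem_image.2 ⟨(x, y), mem_product.2 ⟨hx, hy⟩, rfl⟩)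
    have h2 := hY ((X ×ˢ X).image (fun y => e * y.1 + n * y.2)) (by
      intro η hη
      obtain ⟨⟨x, y⟩, hxy, rfl⟩ := mem_image.1 hη
      rw [mem_product] at hxy
      exact hb x hxy.1 y hxy.2)
    have h3 : (X.card : ℝ) ^ 2 ≤ 2 * Q * A.card := le_trans (by exact_mod_cast h1) h2
    nlinarith
  by_cases hXtriv : ∃ v ∈ X, (1 : F) ≠ v
  swap
  · left
    push Not at hXtriv
    have : X ⊆ {1} := fun v hv => mem_singleton.2 (hXtriv v hv).symm
    have : (X.card : ℝ) ≤ 1 := by exact_mod_cast card_le_card this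
    have h3 : (X.card : ℝ) ^ 2 ≤ 1 := pow_le_one₀ (by positivity) this
    nlinarith
  obtain ⟨v, hv, hv1⟩ := hXtriv
  by_cases c1 : ∀ ξ ∈ ratioSet X, 1 + ξ ∈ ratioSet X
  swap
  · left
    push Not at c1
    obtain ⟨ξ, ⟨a, ha, b, hb, c, hc, d, hd, hcd, rfl⟩, hn⟩ := c1
    refine big ((c - d) + (a - b)) (c - d) _ (sub_ne_zero.2 hcd) ?_ hn
      (fun x hx y hy => hadd ha hb hc hd hx hy)
    rw [add_div, div_self (sub_ne_zero.2 hcd)]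
  by_cases c2 : ∀ ξ ∈ ratioSet X, ∀ z ∈ X, z * ξ ∈ ratioSet X
  swap
  · left
    push Not at c2
    obtain ⟨ξ, ⟨a, ha, b, hb, c, hc, d, hd, hcd, rfl⟩, z, hz, hn⟩ := c2
    exact big (z * (a - b)) (c - d) _ (sub_ne_zero.2 hcd) (mul_div_assoc _ _ _).symm hn
      (fun x hx y hy => hmul ha hb hc hd hz hx hy)
  obtain ⟨R, hXR, hRX⟩ := subset_ratioSet_of_stable hX0 hX1 hv hv1 c1 c2
  have hfin : Fintype F := Fintype.ofFinite F
  classical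
  set RF : Finset F := univ.filter (fun x => x ∈ R) with hRF
  have hRcard : (RF.card : ℝ) = Nat.card R := by
    have : RF.card = Nat.card R := by
      rw [hRF, Nat.card_eq_fintype_card, Fintype.card_subtype]
    rw [this]
  have hX : (0 : ℝ) < X.card := by exact_mod_cast card_pos.2 ⟨1, hX1⟩
  have hRFne : RF.Nonempty := ⟨1, by simp [hRF, one_mem]⟩
  have hr : (0 : ℝ) < RF.card := by exact_mod_cast hRFne.card_pos
  -- On average over R the energy of X is low, so for some ξ ∈ R the set X + ξX has at least about
  -- min(|X|², |R|) elements. As ξ is a ratio, a dilate of this set consists of good multipliers and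
  -- has at most 2Q|A| elements.
  obtain ⟨ξ, hξ, hE⟩ : ∃ ξ ∈ RF, (RF.card : ℝ) * dilateEnergy X ξ ≤
      (X.card : ℝ) ^ 4 + (X.card : ℝ) ^ 2 * RF.card := by
    by_contra! hcon
    have h1 := sum_lt_sum_of_nonempty hRFne hcon
    rw [sum_const, nsmul_eq_mul, ← mul_sum] at h1
    have h2 := lt_of_mul_lt_mul_left h1 hr.le
    linarith [sum_dilateEnergy_le' X RF]
  obtain ⟨a, ha', b, hb, c, hc, d, hd, hcd, hξe⟩ := hRX ξ (by simpa [hRF] using hξ)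
  have hcd' := sub_ne_zero.2 hcd
  have hYs := hY ((c - d) • (X + ξ • X)) (by
    intro η hη
    obtain ⟨w, hw, rfl⟩ := mem_smul_finset.1 hη
    obtain ⟨x, hx, w', hw', rfl⟩ := mem_add.1 hw
    obtain ⟨y, hy, rfl⟩ := mem_smul_finset.1 hw'
    have e : (c - d) • (x + ξ • y) = (c - d) * x + 1 * (a - b) * y := by
      rw [hξe, smul_eq_mul, smul_eq_mul, mul_add, ← mul_assoc, mul_div_cancel₀ _ hcd', one_mul]
    rw [e]
    exact hmul ha' hb hc hd hX1 hx hy)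
  rw [card_smul_finset_of_ne_zero hcd'] at hYs
  have h4 := card_pow_four_le_mul_dilateEnergy X ξ
  have h5 : (RF.card : ℝ) * (X.card : ℝ) ^ 4 ≤
      2 * Q * A.card * ((X.card : ℝ) ^ 4 + (X.card : ℝ) ^ 2 * RF.card) := by
    calc (RF.card : ℝ) * (X.card : ℝ) ^ 4 ≤ RF.card * ((X + ξ • X).card * dilateEnergy X ξ) := by
          gcongr
      _ = (X + ξ • X).card * (RF.card * dilateEnergy X ξ) := by ring
      _ ≤ _ := mul_le_mul hYs hE (by positivity) (by positivity)
  by_cases hcase : (X.card : ℝ) ^ 2 ≤ RF.card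
  · left
    have h6 : (X.card : ℝ) ^ 4 + (X.card : ℝ) ^ 2 * RF.card ≤
        2 * (X.card : ℝ) ^ 2 * RF.card := by
      nlinarith [mul_le_mul_of_nonneg_left hcase (sq_nonneg (X.card : ℝ))]
    have h7 := h5.trans (mul_le_mul_of_nonneg_left h6 (by positivity))
    refine le_of_mul_le_mul_right (a := (X.card : ℝ) ^ 2 * RF.card) ?_ (by positivity)
    linarith
  · right
    refine ⟨R, hXR, ?_⟩
    rw [← hRcard]
    have h6 : (X.card : ℝ) ^ 4 + (X.card : ℝ) ^ 2 * RF.card ≤ 2 * (X.card : ℝ) ^ 4 := by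
      nlinarith [mul_le_mul_of_nonneg_left (not_le.1 hcase).le (sq_nonneg (X.card : ℝ))]
    have h7 := h5.trans (mul_le_mul_of_nonneg_left h6 (by positivity))
    refine le_of_mul_le_mul_right (a := (X.card : ℝ) ^ 4) ?_ (by positivity)
    linarith

/-- If `X` lies in a subfield `R` and `A` has few sums with its dilates by elements of `X`, then
`A` meets some affine copy of `R` in a large set. -/
theorem exists_large_inter_affine_subfield (hA : A.Nonempty) (hK : 0 < K) (hX : X.Nonempty)
    (h : ∀ x ∈ X, ((A + x • A).card : ℝ) ≤ K * A.card) (hAK : 2 * K ≤ A.card)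
    (R : Subfield F) (hR : ∀ x ∈ X, x ∈ R) :
    ∃ c e : F, c ≠ 0 ∧ ∃ A' ⊆ A, (X.card : ℝ) / (2 * K) ≤ A'.card ∧
      ∀ a ∈ A', ∃ g ∈ R, a = c * g + e := by
  classical
  have ha : (0 : ℝ) < A.card := by exact_mod_cast hA.card_pos
  have hX' : (0 : ℝ) < X.card := by exact_mod_cast hX.card_pos
  have h1 : (X.card : ℝ) * ((A.card : ℝ) ^ 3 / K) ≤ ∑ η ∈ X, (dilateEnergy A η : ℝ) := by
    rw [← nsmul_eq_mul]
    refine card_nsmul_le_sum _ _ _ fun η hη => ?_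
    rw [div_le_iff₀ hK]
    have h2 := card_pow_four_le_mul_dilateEnergy A η
    have h3 : ((A + η • A).card : ℝ) * dilateEnergy A η ≤ K * A.card * dilateEnergy A η :=
      mul_le_mul_of_nonneg_right (h η hη) (by positivity)
    refine le_of_mul_le_mul_left (a := (A.card : ℝ)) ?_ ha
    calc (A.card : ℝ) * (A.card : ℝ) ^ 3 = (A.card : ℝ) ^ 4 := by ring
      _ ≤ _ := h2.trans h3
      _ = _ := by ring
  have h2 := h1.trans (sum_dilateEnergy_le A X)
  set T := ((A ×ˢ A) ×ˢ (A ×ˢ A)).filter (fun q => q.1.2 ≠ q.2.2 ∧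
        ∃ η ∈ X, q.1.1 + η * q.1.2 = q.2.1 + η * q.2.2) with hT
  have h3 : (A.card : ℝ) ^ 2 * X.card ≤ (X.card : ℝ) * ((A.card : ℝ) ^ 3 / K) / 2 := by
    have : (A.card : ℝ) ^ 2 ≤ (A.card : ℝ) ^ 3 / K / 2 := by
      rw [le_div_iff₀ (by norm_num), le_div_iff₀ hK]
      nlinarith [mul_le_mul_of_nonneg_left hAK (sq_nonneg (A.card : ℝ))]
    calc (A.card : ℝ) ^ 2 * X.card ≤ (A.card : ℝ) ^ 3 / K / 2 * X.card := by gcongr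
      _ = _ := by ring
  have h4 : (X.card : ℝ) / (2 * K) * (A.card : ℝ) ^ 3 ≤ T.card := by
    have e : (X.card : ℝ) / (2 * K) * (A.card : ℝ) ^ 3 =
      (X.card : ℝ) * ((A.card : ℝ) ^ 3 / K) / 2 := by field_simp
    linarith
  have hfib : (T.card : ℝ) = ∑ z ∈ A ×ˢ (A ×ˢ A),
      ((T.filter (fun q => (q.2.1, q.1.2, q.2.2) = z)).card : ℝ) := by
    rw [← Nat.cast_sum]
    congr 1
    refine card_eq_sum_card_fiberwise
      (f := fun q : (F × F) × F × F => (q.2.1, q.1.2, q.2.2)) fun q hq => ?_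
    rw [mem_coe, hT, mem_filter] at hq
    simp only [mem_product, mem_coe] at hq ⊢
    tauto
  -- Pigeonhole over |A|³ triples: once a₂, a₃, a₄ are fixed, a₁ = a₃ + η(a₄ - a₂) runs through an
  -- affine copy of R.
  obtain ⟨⟨a3, a2, a4⟩, hz, hb⟩ : ∃ z ∈ A ×ˢ (A ×ˢ A), (X.card : ℝ) / (2 * K) ≤
      ((T.filter (fun q => (q.2.1, q.1.2, q.2.2) = z)).card : ℝ) := by
    by_contra! hcon
    have h5 := sum_lt_sum_of_nonempty (hA.product (hA.product hA)) hcon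
    rw [← hfib, sum_const, nsmul_eq_mul] at h5
    simp only [card_product, Nat.cast_mul] at h5
    nlinarith
  set W := T.filter (fun q => (q.2.1, q.1.2, q.2.2) = (a3, a2, a4))
  have hW : ∀ q ∈ W, q.1.1 ∈ A ∧ a2 ≠ a4 ∧ q.1.2 = a2 ∧ q.2.1 = a3 ∧ q.2.2 = a4 ∧
      ∃ η ∈ X, q.1.1 + η * a2 = a3 + η * a4 := by
    intro q hq
    obtain ⟨hq, he⟩ := mem_filter.1 hq
    simp only [Prod.mk.injEq] at he
    obtain ⟨e1, e2, e3⟩ := he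
    rw [hT, mem_filter, e1, e2, e3] at hq
    simp only [mem_product] at hq
    exact ⟨hq.1.1.1, hq.2.1, e2, e1, e3, hq.2.2⟩
  have hWpos : W.Nonempty := by
    rw [← card_pos]
    have : (0 : ℝ) < W.card := lt_of_lt_of_le (by positivity) hb
    exact_mod_cast this
  obtain ⟨q, hq⟩ := hWpos
  refine ⟨a4 - a2, a3, sub_ne_zero.2 (hW q hq).2.1.symm, W.image (fun q => q.1.1), ?_, ?_, ?_⟩
  · intro a ha
    obtain ⟨q, hq, rfl⟩ := mem_image.1 ha
    exact (hW q hq).1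
  · rw [card_image_of_injOn]
    · exact hb
    · rintro ⟨⟨q1, q2⟩, q3, q4⟩ hq ⟨⟨q1', q2'⟩, q3', q4'⟩ hq' he
      have h1 := hW _ hq
      have h2 := hW _ hq'
      dsimp only at h1 h2 he
      obtain ⟨-, -, rfl, rfl, rfl, -⟩ := h1
      obtain ⟨-, -, rfl, rfl, rfl, -⟩ := h2
      rw [he]
  · intro a ha
    obtain ⟨q, hq, rfl⟩ := mem_image.1 ha
    obtain ⟨-, -, -, -, -, η, hη, he⟩ := hW q hq
    exact ⟨η, hR η hη, by linear_combination he⟩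

end Pivot

/-! ### Projections of planar sets over a finite field. -/

section Projections
variable {F : Type*} [Field F] [DecidableEq F]

/-- A lower bound for the number of triples of distinct elements. -/
theorem card_pow_three_le_card_distinct_triples {α : Type*} [DecidableEq α] (D : Finset α) :
    (D.card : ℝ) ^ 3 ≤
      (((D ×ˢ D) ×ˢ D).filter (fun t => t.1.1 ≠ t.1.2 ∧ t.2 ≠ t.1.1 ∧ t.2 ≠ t.1.2)).card
        + 3 * (D.card : ℝ) ^ 2 := by
  set U := ((D ×ˢ D) ×ˢ D).filter (fun t => t.1.1 ≠ t.1.2 ∧ t.2 ≠ t.1.1 ∧ t.2 ≠ t.1.2) with hU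
  have hsub : (D ×ˢ D) ×ˢ D ⊆ U ∪ ((D ×ˢ D).image (fun y => ((y.1, y.1), y.2)) ∪
      ((D ×ˢ D).image (fun y => ((y.1, y.2), y.1)) ∪
        (D ×ˢ D).image (fun y => ((y.1, y.2), y.2)))) := by
    rintro ⟨⟨a, b⟩, c⟩ h
    simp only [hU, mem_union, mem_filter, mem_image, mem_product, Prod.mk.injEq, Prod.exists]
    simp only [mem_product] at h
    by_cases h1 : a = b
    · right; left; exact ⟨a, c, ⟨h.1.1, h.2⟩, ⟨rfl, h1⟩, rfl⟩
    by_cases h2 : c = a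
    · right; right; left; exact ⟨a, b, h.1, ⟨rfl, rfl⟩, h2.symm⟩
    by_cases h3 : c = b
    · right; right; right; exact ⟨a, b, h.1, ⟨rfl, rfl⟩, h3.symm⟩
    exact Or.inl ⟨h, h1, h2, h3⟩
  have hc : ∀ f : α × α → (α × α) × α, ((D ×ˢ D).image f).card ≤ D.card ^ 2 := fun f =>
    card_image_le.trans (by rw [card_product, sq])
  have h := card_le_card hsub
  have h2 := (h.trans (card_union_le _ _)).trans (Nat.add_le_add_left ((card_union_le _ _).trans
    (Nat.add_le_add (hc _) ((card_union_le _ _).trans (Nat.add_le_add (hc _) (hc _))))) _)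
  rw [card_product, card_product] at h2
  have h3 : D.card ^ 3 ≤ U.card + 3 * D.card ^ 2 := by
    calc D.card ^ 3 = D.card * D.card * D.card := by ring
      _ ≤ _ := h2
      _ = _ := by ring
  exact_mod_cast h3

/-- Choice of two directions: if most projections of `Λ` fall in small sets, two of the directions
can be used as coordinates so that many others project a dense part of the grid. -/
theorem exists_two_directions (D : Finset F) (Λ : Finset (F × F)) (Y : F → Finset F) (N κ : ℝ)
    (hκ : 0 < κ) (hN : 24 * κ ^ 3 ≤ N) (hD : (D.card : ℝ) ≤ 2 * N)
    (hΛ : (Λ.card : ℝ) ≤ N ^ 2)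
    (h : N ^ 3 / κ ≤ ∑ d ∈ D, ((Λ.filter (fun l => l.1 + d * l.2 ∈ Y d)).card : ℝ)) :
    ∃ d₀ ∈ D, ∃ d₁ ∈ D, d₀ ≠ d₁ ∧ ∃ D' ⊆ D, (2 * N) / (128 * κ ^ 3) ≤ D'.card ∧
      ∀ d ∈ D', d ≠ d₀ ∧ d ≠ d₁ ∧ (2 * N) ^ 2 / (128 * κ ^ 3) ≤
        ((Λ.filter (fun l => l.1 + d₀ * l.2 ∈ Y d₀ ∧ l.1 + d₁ * l.2 ∈ Y d₁ ∧
          l.1 + d * l.2 ∈ Y d)).card : ℝ) := by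
  have hN0 : 0 < N := lt_of_lt_of_le (by positivity) hN
  let E : F × F → Finset F := fun l => D.filter (fun d => l.1 + d * l.2 ∈ Y d)
  let g : F × F → ℝ := fun l => ((E l).card : ℝ)
  have hg1 : N ^ 3 / κ ≤ ∑ l ∈ Λ, g l := by
    rw [sum_card_filter_comm] at h; exact h
  have hgN : ∀ l, g l ≤ 2 * N := fun l => le_trans (Nat.cast_le.2 (card_filter_le _ _)) hD
  have hΛpos : (0 : ℝ) < Λ.card := by
    have : Λ.Nonempty := by
      rw [nonempty_iff_ne_empty]; rintro rfl
      rw [sum_empty] at hg1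
      have : 0 < N ^ 3 / κ := by positivity
      linarith
    exact_mod_cast this.card_pos
  -- The third moment counts points with three good directions: two become coordinates, the third is
  -- a projection. Coinciding directions cost at most 12N⁴.
  have hg3 : N ^ 5 / κ ^ 3 ≤ ∑ l ∈ Λ, g l ^ 3 := by
    have h1 := pow_sum_div_card_le_sum_pow (s := Λ) (f := g) (n := 2)
      (fun l _ => Nat.cast_nonneg _)
    refine le_trans ?_ h1
    rw [le_div_iff₀ (by positivity)]
    calc N ^ 5 / κ ^ 3 * (Λ.card : ℝ) ^ 2 ≤ N ^ 5 / κ ^ 3 * (N ^ 2) ^ 2 := by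
          refine mul_le_mul_of_nonneg_left (pow_le_pow_left₀ hΛpos.le hΛ 2) (by positivity)
      _ = (N ^ 3 / κ) ^ 3 := by field_simp
      _ ≤ _ := pow_le_pow_left₀ (by positivity) hg1 3
  have hg2 : ∑ l ∈ Λ, 3 * g l ^ 2 ≤ 12 * N ^ 4 := by
    calc _ ≤ Λ.card • (3 * (2 * N) ^ 2) := sum_le_card_nsmul _ _ _ fun l _ => by
          have := pow_le_pow_left₀ (Nat.cast_nonneg _ : 0 ≤ g l) (hgN l) 2
          linarith
      _ = Λ.card * (3 * (2 * N) ^ 2) := nsmul_eq_mul _ _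
      _ ≤ N ^ 2 * (3 * (2 * N) ^ 2) := by gcongr
      _ = _ := by ring
  let T : Finset ((F × F) × F) :=
    ((D ×ˢ D) ×ˢ D).filter (fun t => t.1.1 ≠ t.1.2 ∧ t.2 ≠ t.1.1 ∧ t.2 ≠ t.1.2)
  let P : F × F → (F × F) × F → Prop := fun l t =>
    l.1 + t.1.1 * l.2 ∈ Y t.1.1 ∧ l.1 + t.1.2 * l.2 ∈ Y t.1.2 ∧ l.1 + t.2 * l.2 ∈ Y t.2
  have hT : ∑ l ∈ Λ, g l ^ 3 ≤ ∑ t ∈ T, ((Λ.filter (fun l => P l t)).card : ℝ) + 12 * N ^ 4 := by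
    rw [← sum_card_filter_comm Λ T P]
    refine le_trans ?_ (add_le_add_right hg2 _)
    rw [← sum_add_distrib]
    refine sum_le_sum fun l _ => ?_
    refine (card_pow_three_le_card_distinct_triples (E l)).trans ?_
    gcongr
    rintro ⟨⟨a, b⟩, c⟩ ht
    simp only [E, T, P, mem_filter, mem_product] at ht ⊢
    tauto
  have hT2 : N ^ 5 / (2 * κ ^ 3) ≤ ∑ t ∈ T, ((Λ.filter (fun l => P l t)).card : ℝ) := by
    have e : N ^ 5 / κ ^ 3 = N ^ 5 / (2 * κ ^ 3) + N ^ 5 / (2 * κ ^ 3) := by ring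
    have : 12 * N ^ 4 ≤ N ^ 5 / (2 * κ ^ 3) := by
      rw [le_div_iff₀ (by positivity)]
      nlinarith [mul_le_mul_of_nonneg_left hN (by positivity : 0 ≤ N ^ 4)]
    linarith
  -- The value 0 on degenerate triples turns the sum over `T` into an iterated sum.
  let H : F × F → F → ℝ := fun y d => if y.1 ≠ y.2 ∧ d ≠ y.1 ∧ d ≠ y.2 then
    ((Λ.filter (fun l => P l (y, d))).card : ℝ) else 0
  have hT3 : ∑ t ∈ T, ((Λ.filter (fun l => P l t)).card : ℝ) = ∑ y ∈ D ×ˢ D, ∑ d ∈ D, H y d := by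
    rw [sum_filter, sum_product]
  rw [hT3] at hT2
  have hDD : ((D ×ˢ D).card : ℝ) ≤ (2 * N) ^ 2 := by
    rw [card_product, Nat.cast_mul, sq]; gcongr
  obtain ⟨⟨d₀, d₁⟩, hy, hH⟩ : ∃ y ∈ D ×ˢ D, N ^ 3 / (8 * κ ^ 3) ≤ ∑ d ∈ D, H y d := by
    by_contra! hcon
    have hne : (D ×ˢ D).Nonempty := by
      rw [nonempty_iff_ne_empty]; intro h0
      rw [h0, sum_empty] at hT2
      have : 0 < N ^ 5 / (2 * κ ^ 3) := by positivity
      linarith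
    have h1 := sum_lt_sum_of_nonempty hne hcon
    rw [sum_const, nsmul_eq_mul] at h1
    have h2 : ((D ×ˢ D).card : ℝ) * (N ^ 3 / (8 * κ ^ 3)) ≤ (2 * N) ^ 2 * (N ^ 3 / (8 * κ ^ 3)) :=
      mul_le_mul_of_nonneg_right hDD (by positivity)
    have e : (2 * N) ^ 2 * (N ^ 3 / (8 * κ ^ 3)) = N ^ 5 / (2 * κ ^ 3) := by field_simp; ring
    linarith
  rw [mem_product] at hy
  have hw : 0 < (2 * N) ^ 2 / (128 * κ ^ 3) := by positivity
  have h5 := sum_le_sum_filter_add D (H (d₀, d₁)) ((2 * N) ^ 2 / (128 * κ ^ 3)) (2 * N) hw.le hD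
  set D' := D.filter (fun d => (2 * N) ^ 2 / (128 * κ ^ 3) ≤ H (d₀, d₁) d) with hD'
  have hHΛ : ∀ d, H (d₀, d₁) d ≤ N ^ 2 := by
    intro d
    simp only [H]
    split_ifs
    · exact le_trans (by exact_mod_cast card_filter_le _ _) hΛ
    · positivity
  have h6 : ∑ d ∈ D', H (d₀, d₁) d ≤ D'.card * (2 * N) ^ 2 := by
    rw [← nsmul_eq_mul]
    exact sum_le_card_nsmul _ _ _ fun d _ => (hHΛ d).trans (by nlinarith)
  have h7 : 2 * N / (128 * κ ^ 3) ≤ D'.card := by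
    have e : N ^ 3 / (8 * κ ^ 3) = 2 * N / (128 * κ ^ 3) * (2 * N) ^ 2 +
        (2 * N) ^ 2 / (128 * κ ^ 3) * (2 * N) := by field_simp; ring
    exact le_of_mul_le_mul_right (a := (2 * N) ^ 2) (by linarith) (by positivity)
  have hgood : ∀ d ∈ D', (d₀ ≠ d₁ ∧ d ≠ d₀ ∧ d ≠ d₁) ∧ (2 * N) ^ 2 / (128 * κ ^ 3) ≤
      ((Λ.filter (fun l => P l ((d₀, d₁), d))).card : ℝ) := by
    intro d hd
    have h8 := (mem_filter.1 hd).2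
    simp only [H] at h8
    split_ifs at h8 with h9
    · exact ⟨h9, h8⟩
    · linarith
  have hne : D'.Nonempty := by
    rw [← card_pos]
    have : (0 : ℝ) < D'.card := lt_of_lt_of_le (by positivity) h7
    exact_mod_cast this
  obtain ⟨d, hd⟩ := hne
  refine ⟨d₀, hy.1, d₁, hy.2, (hgood d hd).1.1, D', filter_subset _ _, h7, fun d hd => ?_⟩
  exact ⟨(hgood d hd).1.2.1, (hgood d hd).1.2.2, (hgood d hd).2⟩

/-- A projection theorem over finite fields: a set of `N²` points with about `N` projections
falling into sets of size about `N` forces one of these sets to concentrate on an affine copy of a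
small subfield. -/
theorem exists_subfield_of_small_projections [Finite F] (D : Finset F) (Λ : Finset (F × F))
    (Y : F → Finset F) (N κ K K' : ℝ) (hκ : 0 < κ) (hN : 24 * κ ^ 3 ≤ N)
    (hD : (D.card : ℝ) ≤ 2 * N) (hΛ : (Λ.card : ℝ) ≤ N ^ 2)
    (hY : ∀ d ∈ D, ((Y d).card : ℝ) ≤ 2 * N)
    (h : N ^ 3 / κ ≤ ∑ d ∈ D, ((Λ.filter (fun l => l.1 + d * l.2 ∈ Y d)).card : ℝ))
    (hK : K = 128 * κ ^ 3) (hK1 : 1 ≤ K) (hK' : K' = 2 * (2 ^ 12 * K ^ 5) ^ 6 * (6 * K) ^ 8)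
    (hbig : 16 * 6 ^ 8 * 7 ^ 7 * K ^ 10 * K' ^ 15 < 2 * N) :
    ∃ d ∈ D, ∃ R : Subfield F, ∃ c e : F, c ≠ 0 ∧ ∃ A' ⊆ Y d,
      2 * N / (4 * 6 ^ 4 * K ^ 5 * K') ≤ A'.card ∧ (∀ a ∈ A', ∃ g ∈ R, a = c * g + e) ∧
      (Nat.card R : ℝ) ≤ 4 * (7 ^ 7 * K' ^ 15) * (2 * N) := by
  have hN0 : 0 < N := lt_of_lt_of_le (by positivity) hN
  have hK0 : 0 < K := by linarith
  obtain ⟨d₀, hd₀, d₁, hd₁, hne, D', hD'D, hD', hgood⟩ :=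
    exists_two_directions D Λ Y N κ hκ hN hD hΛ h
  rw [← hK] at hD' hgood
  obtain ⟨M, hM⟩ : ∃ M, M = 2 * N := ⟨_, rfl⟩
  rw [← hM] at hD' hgood hD hY hbig ⊢
  have hM0 : 0 < M := by rw [hM]; positivity
  -- In the coordinates u = l₁ + d₀l₂ and v = l₁ + d₁l₂, u + xv is 1 + x times the projection in
  -- direction `δ x`; `φ` is the inverse of `δ` on `D'`.
  let δ : F → F := fun x => (x * d₁ + d₀) / (1 + x)
  let φ : F → F := fun d => (d - d₀) / (d₁ - d)
  have h1φ : ∀ d ∈ D', 1 + φ d ≠ 0 := by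
    intro d hd
    have h1 : d₁ - d ≠ 0 := sub_ne_zero.2 (hgood d hd).2.1.symm
    have e : 1 + φ d = (d₁ - d₀) / (d₁ - d) := by simp only [φ]; field_simp; ring
    rw [e]
    exact div_ne_zero (sub_ne_zero.2 hne.symm) h1
  have hδφ : ∀ d ∈ D', δ (φ d) = d := by
    intro d hd
    have h1 : d₁ - d ≠ 0 := sub_ne_zero.2 (hgood d hd).2.1.symm
    rw [div_eq_iff (h1φ d hd)]
    simp only [φ]
    field_simp
    ring
  set X := D'.image φ with hX
  have hXcard : (X.card : ℝ) = D'.card := by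
    rw [card_image_of_injOn]
    intro a ha b hb hab
    rw [← hδφ a ha, ← hδφ b hb]
    exact congrArg δ hab
  have hXne : X.Nonempty := by
    rw [← card_pos]
    have : (0 : ℝ) < X.card := by
      rw [hXcard]; exact lt_of_lt_of_le (by positivity) hD'
    exact_mod_cast this
  have hX0 : (0 : F) ∉ X := by
    intro h0
    obtain ⟨d, hd, hd0⟩ := mem_image.1 h0
    rcases div_eq_zero_iff.1 hd0 with h1 | h1
    · exact (hgood d hd).1 (sub_eq_zero.1 h1)
    · exact (hgood d hd).2.1 (sub_eq_zero.1 h1).symm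
  have hXmem : ∀ x ∈ X, 1 + x ≠ 0 ∧ δ x ∈ D' := by
    intro x hx
    obtain ⟨d, hd, rfl⟩ := mem_image.1 hx
    exact ⟨h1φ d hd, by rw [hδφ d hd]; exact hd⟩
  obtain ⟨A₀, hA₀, X₁, h1X, h0X, hA₀M, hX₁, hsum⟩ := exists_small_dilate_sums (Y d₀) (Y d₁) X hXne
    hX0 (fun x => (1 + x) • Y (δ x))
    (fun x u v => ∃ l ∈ Λ, l.1 + d₀ * l.2 = u ∧ l.1 + d₁ * l.2 = v ∧ l.1 + δ x * l.2 ∈ Y (δ x))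
    M K hM0 hK0 (hY d₀ hd₀) (hY d₁ hd₁)
    (fun x hx => by
      rw [card_smul_finset_of_ne_zero (hXmem x hx).1]
      exact hY _ (hD'D (hXmem x hx).2))
    (fun x hx u _ v _ hr => by
      obtain ⟨l, -, rfl, rfl, hl⟩ := hr
      refine mem_smul_finset.2 ⟨_, hl, ?_⟩
      have := (hXmem x hx).1
      simp only [δ, smul_eq_mul]
      field_simp
      ring)
    (fun x hx => by
      refine (hgood _ (hXmem x hx).2).2.2.trans ?_
      rw [← Nat.cast_sum, ← card_sigma, Nat.cast_le]
      refine card_le_card_of_injOn (fun l => ⟨l.1 + d₀ * l.2, l.1 + d₁ * l.2⟩) ?_ ?_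
      · intro l hl
        simp only [mem_coe, mem_filter, mem_sigma] at hl ⊢
        exact ⟨hl.2.1, hl.2.2.1, l, hl.1, rfl, rfl, hl.2.2.2⟩
      · rintro ⟨a, b⟩ _ ⟨a', b'⟩ _ he
        simp only [Sigma.mk.injEq, heq_eq_eq] at he
        have e1 : (d₁ - d₀) * (b - b') = 0 := by linear_combination he.2 - he.1
        rcases mul_eq_zero.1 e1 with h1 | h1
        · exact absurd (sub_eq_zero.1 h1).symm hne
        · have e2 := sub_eq_zero.1 h1
          subst e2
          rw [add_right_cancel he.1])
  rw [← hK'] at hsum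
  have hK'1 : 1 ≤ K' := by
    rw [hK']
    have h1 : 1 ≤ K ^ 5 := one_le_pow₀ hK1
    have h2 : 1 ≤ (2 ^ 12 * K ^ 5) ^ 6 := one_le_pow₀ (by linarith)
    have h3 : 1 ≤ (6 * K) ^ 8 := one_le_pow₀ (by linarith)
    nlinarith
  have hK'0 : 0 < K' := by linarith
  have hA₀le : (A₀.card : ℝ) ≤ M := le_trans (by exact_mod_cast card_le_card hA₀) (hY d₀ hd₀)
  have hX₁' : M / (2 * 6 ^ 4 * K ^ 5) ≤ X₁.card := by
    refine le_trans ?_ hX₁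
    rw [hXcard]
    calc M / (2 * 6 ^ 4 * K ^ 5) = M / K / (2 * (6 * K) ^ 4) := by field_simp
      _ ≤ _ := by gcongr
  have hAK : 2 * (7 ^ 7 * K' ^ 15) ≤ A₀.card := by
    refine le_trans ?_ hA₀M
    rw [le_div_iff₀ (by positivity)]
    refine le_trans ?_ hbig.le
    have h1 : K ≤ K ^ 10 := le_self_pow₀ hK1 (by norm_num)
    calc 2 * (7 ^ 7 * K' ^ 15) * (6 * K) = 12 * (7 ^ 7 * K' ^ 15) * K := by ring
      _ ≤ 12 * (7 ^ 7 * K' ^ 15) * K ^ 10 := by gcongr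
      _ ≤ (16 * 6 ^ 8) * (7 ^ 7 * K' ^ 15) * K ^ 10 := by gcongr; norm_num
      _ = _ := by ring
  have hA₀ne : A₀.Nonempty := by
    rw [← card_pos]
    have : (0 : ℝ) < A₀.card := lt_of_lt_of_le (by positivity) hA₀M
    exact_mod_cast this
  rcases card_sq_le_or_exists_subfield h0X h1X hK'1 hsum hAK with hc | ⟨R, hXR, hR⟩
  -- Both sets have size about M, so |X₁|² ≲ |A₀| would bound M by the constants, against `hbig`.
  · exfalso
    have h1 : (M / (2 * 6 ^ 4 * K ^ 5)) ^ 2 ≤ (X₁.card : ℝ) ^ 2 :=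
      pow_le_pow_left₀ (by positivity) hX₁' 2
    have h2 : 4 * (7 ^ 7 * K' ^ 15) * A₀.card ≤ 4 * (7 ^ 7 * K' ^ 15) * M := by gcongr
    have h3 := (h1.trans hc).trans h2
    have e : (M / (2 * 6 ^ 4 * K ^ 5)) ^ 2 = M * M / (4 * 6 ^ 8 * K ^ 10) := by
      field_simp; norm_num
    rw [e, div_le_iff₀ (by positivity)] at h3
    have h4 : M * M ≤ M * (16 * 6 ^ 8 * 7 ^ 7 * K ^ 10 * K' ^ 15) := by linarith
    linarith [le_of_mul_le_mul_left h4 hM0]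
  · have hAK2 : 2 * K' ≤ A₀.card := by
      refine le_trans ?_ hAK
      have : K' ≤ K' ^ 15 := le_self_pow₀ hK'1 (by norm_num)
      nlinarith
    obtain ⟨c, e, hc, A', hA', hcard, hAff⟩ := exists_large_inter_affine_subfield hA₀ne hK'0
      ⟨1, h1X⟩ hsum hAK2 R hXR
    refine ⟨d₀, hd₀, R, c, e, hc, A', hA'.trans hA₀, ?_, hAff, hR.trans (by gcongr)⟩
    refine le_trans ?_ hcard
    rw [le_div_iff₀ (by positivity)]
    refine le_trans (le_of_eq ?_) hX₁'
    field_simp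
    norm_num

end Projections

/-! ### Incidence counts in partial linear spaces. -/

section LinearSpaces
variable {α β : Type*} [DecidableEq β]

/-- In a partial linear space with at most `N²` points, the lines with more than `2N` points carry
few incidences. -/
theorem sum_card_rich_le (P : Finset α) (L : Finset β) (r : α → β → Prop)
    [∀ a b, Decidable (r a b)]
    (hr : ∀ a a' b b', r a b → r a b' → r a' b → r a' b' → a = a' ∨ b = b')
    (N : ℝ) (hN : 0 < N) (hP : (P.card : ℝ) ≤ N ^ 2) :
    ∑ b ∈ L.filter (fun b => 2 * N < ((P.filter (fun a => r a b)).card : ℝ)),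
      ((P.filter (fun a => r a b)).card : ℝ) ≤ 2 * N ^ 2 := by
  set L' := L.filter (fun b => 2 * N < ((P.filter (fun a => r a b)).card : ℝ)) with hL'
  obtain ⟨I, hI⟩ : ∃ I, I = ∑ b ∈ L', ((P.filter (fun a => r a b)).card : ℝ) := ⟨_, rfl⟩
  have hI0 : 0 ≤ I := by rw [hI]; exact sum_nonneg fun _ _ => Nat.cast_nonneg _
  have h1 : 2 * N * L'.card ≤ I := by
    rw [hI, mul_comm, ← nsmul_eq_mul]
    exact card_nsmul_le_sum _ _ _ fun b hb => (mem_filter.1 hb).2.le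
  have h2 : I = ∑ a ∈ P, ((L'.filter (fun b => r a b)).card : ℝ) := by
    rw [hI, sum_card_filter_comm]
  rw [← hI]
  clear_value L'
  have h3 : I ^ 2 ≤ P.card * ∑ a ∈ P, ((L'.filter (fun b => r a b)).card : ℝ) ^ 2 := by
    rw [h2]; exact sq_sum_le_card_mul_sum_sq
  have h4 : ∑ a ∈ P, ((L'.filter (fun b => r a b)).card : ℝ) ^ 2
      = ∑ y ∈ L' ×ˢ L', ((P.filter (fun a => r a y.1 ∧ r a y.2)).card : ℝ) := by
    rw [← sum_card_filter_comm P (L' ×ˢ L') (fun a y => r a y.1 ∧ r a y.2)]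
    refine sum_congr rfl fun a _ => ?_
    rw [sq, ← Nat.cast_mul, ← card_product, filter_product]
  have h5 : ∑ y ∈ L' ×ˢ L', ((P.filter (fun a => r a y.1 ∧ r a y.2)).card : ℝ)
      ≤ I + (L'.card : ℝ) ^ 2 := by
    have e : I = ∑ y ∈ L' ×ˢ L', if y.1 = y.2 then ((P.filter (fun a => r a y.1)).card : ℝ)
        else 0 := by
      rw [sum_product, hI]
      refine sum_congr rfl fun b hb => ?_
      rw [sum_ite_eq, if_pos hb]
    have e2 : (L'.card : ℝ) ^ 2 = ∑ y ∈ L' ×ˢ L', (1 : ℝ) := by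
      simp [sq]
    rw [e, e2, ← sum_add_distrib]
    refine sum_le_sum fun y _ => ?_
    split_ifs with h
    · rw [h]
      simp only [and_self]
      linarith
    · rw [zero_add, ← Nat.cast_one, Nat.cast_le, card_le_one]
      intro a ha a' ha'
      rw [mem_filter] at ha ha'
      exact (hr a a' y.1 y.2 ha.2.1 ha.2.2 ha'.2.1 ha'.2.2).resolve_right h
  have h6 : I ^ 2 ≤ N ^ 2 * (I + (L'.card : ℝ) ^ 2) := by
    refine h3.trans (mul_le_mul hP (h4 ▸ h5) (by positivity) (by positivity))
  have h7 : (2 * N * L'.card) ^ 2 ≤ I ^ 2 := pow_le_pow_left₀ (by positivity) h1 2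
  -- Since 2N|L'| ≤ I, the bound `h6` gives I² ≤ N²I + I²/4.
  by_contra hcon
  nlinarith

/-- A partial linear space with many incidences has a point `o` such that many pairs of lines
`(l, l')` meet in a point, with `o` on `l'` but not on `l`. -/
theorem exists_center [DecidableEq α] (P : Finset α) (L : Finset β) (r : α → β → Prop)
    [∀ a b, Decidable (r a b)]
    (hr : ∀ a a' b b', r a b → r a b' → r a' b → r a' b' → a = a' ∨ b = b')
    (N κ : ℝ) (hκ : 1 ≤ κ) (hN : 64 * κ ^ 2 ≤ N) (hP : (P.card : ℝ) ≤ N ^ 2)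
    (hL : (L.card : ℝ) ≤ N ^ 2)
    (hI : N ^ 3 / κ ≤ ∑ b ∈ L, ((P.filter (fun a => r a b)).card : ℝ)) :
    ∃ P₁ ⊆ P, ∃ L₁ ⊆ L,
      (∀ b ∈ L₁, N / (4 * κ) ≤ ((P₁.filter (fun a => r a b)).card : ℝ) ∧
        ((P₁.filter (fun a => r a b)).card : ℝ) ≤ 2 * N) ∧
      ∃ o ∈ P₁, ((L₁.filter (fun b => r o b)).card : ℝ) ≤ 2 * N ∧
        N ^ 3 / (256 * κ ^ 3) ≤ (((L₁ ×ˢ L₁).filter (fun y => r o y.2 ∧ ¬ r o y.1 ∧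
          ∃ q ∈ P₁, r q y.1 ∧ r q y.2)).card : ℝ) := by
  have hκ0 : 0 < κ := by linarith
  have hN0 : 0 < N := lt_of_lt_of_le (by positivity) hN
  have hκN : 64 * κ ≤ N := by nlinarith
  -- discard the rich lines
  set L0 := L.filter (fun b => ¬ 2 * N < ((P.filter (fun a => r a b)).card : ℝ)) with hL0
  have h1 : N ^ 3 / κ - 2 * N ^ 2 ≤ ∑ a ∈ P, ((L0.filter (fun b => r a b)).card : ℝ) := by
    rw [← sum_card_filter_comm P L0 r |>.symm]
    have h := sum_card_rich_le P L r hr N hN0 hP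
    have h' := sum_filter_add_sum_filter_not L
      (fun b => 2 * N < ((P.filter (fun a => r a b)).card : ℝ))
      (fun b => ((P.filter (fun a => r a b)).card : ℝ))
    linarith
  -- discard the rich points
  set P1 := P.filter (fun a => ¬ 2 * N < ((L0.filter (fun b => r a b)).card : ℝ)) with hP1
  have hL0N : (L0.card : ℝ) ≤ N ^ 2 := le_trans (Nat.cast_le.2 (card_filter_le _ _)) hL
  have hP1N : (P1.card : ℝ) ≤ N ^ 2 := le_trans (Nat.cast_le.2 (card_filter_le _ _)) hP
  have h2 : N ^ 3 / (2 * κ) ≤ ∑ b ∈ L0, ((P1.filter (fun a => r a b)).card : ℝ) := by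
    rw [← sum_card_filter_comm P1 L0 r]
    have h := sum_card_rich_le L0 P (fun b a => r a b)
      (fun b b' a a' h1 h2 h3 h4 => (hr a a' b b' h1 h3 h2 h4).symm) N hN0 hL0N
    have h' := sum_filter_add_sum_filter_not P
      (fun a => 2 * N < ((L0.filter (fun b => r a b)).card : ℝ))
      (fun a => ((L0.filter (fun b => r a b)).card : ℝ))
    have e : N ^ 3 / κ = N ^ 3 / (2 * κ) + N ^ 3 / (2 * κ) := by ring
    have : 4 * N ^ 2 ≤ N ^ 3 / (2 * κ) := by
      rw [le_div_iff₀ (by positivity)]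
      nlinarith [mul_le_mul_of_nonneg_left hκN (by positivity : 0 ≤ N ^ 2)]
    linarith
  -- discard the poor lines
  have h3 := sum_le_sum_filter_add L0 (fun b => ((P1.filter (fun a => r a b)).card : ℝ))
    (N / (4 * κ)) (N ^ 2) (by positivity) hL0N
  set L2 := L0.filter (fun b => N / (4 * κ) ≤ ((P1.filter (fun a => r a b)).card : ℝ)) with hL2
  have h4 : N ^ 3 / (4 * κ) ≤ ∑ a ∈ P1, ((L2.filter (fun b => r a b)).card : ℝ) := by
    rw [sum_card_filter_comm P1 L2 r]
    have e : N ^ 3 / (2 * κ) = N ^ 3 / (4 * κ) + N / (4 * κ) * N ^ 2 := by ring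
    linarith
  have hL2L0 : L2 ⊆ L0 := filter_subset _ _
  have hdeg : ∀ a ∈ P1, ((L2.filter (fun b => r a b)).card : ℝ) ≤ 2 * N := fun a ha =>
    le_trans (Nat.cast_le.2 (card_le_card (filter_subset_filter _ hL2L0)))
      (not_lt.1 (mem_filter.1 ha).2)
  have h5 : N ^ 4 / (16 * κ ^ 2) ≤ ∑ a ∈ P1, ((L2.filter (fun b => r a b)).card : ℝ) ^ 2 := by
    have h := sq_sum_le_card_mul_sum_sq (s := P1)
      (f := fun a => ((L2.filter (fun b => r a b)).card : ℝ))
    have h' := pow_le_pow_left₀ (by positivity) h4 2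
    have e : (N ^ 3 / (4 * κ)) ^ 2 = N ^ 2 * (N ^ 4 / (16 * κ ^ 2)) := by ring
    rw [e] at h'
    refine le_of_mul_le_mul_left (h'.trans (h.trans ?_)) (by positivity : 0 < N ^ 2)
    exact mul_le_mul_of_nonneg_right hP1N (sum_nonneg fun _ _ => sq_nonneg _)
  have h6 : N ^ 4 / (32 * κ ^ 2) ≤
      ∑ a ∈ P1, (((L2.filter (fun b => r a b)).offDiag).card : ℝ) := by
    have e : ∀ a ∈ P1, (((L2.filter (fun b => r a b)).offDiag).card : ℝ) =
        ((L2.filter (fun b => r a b)).card : ℝ) ^ 2 - (L2.filter (fun b => r a b)).card := by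
      intro a _
      rw [offDiag_card, Nat.cast_sub (Nat.le_mul_self _), Nat.cast_mul, sq]
    rw [sum_congr rfl e, sum_sub_distrib]
    have h' : ∑ a ∈ P1, ((L2.filter (fun b => r a b)).card : ℝ) ≤ N ^ 2 * (2 * N) := by
      refine (sum_le_card_nsmul _ _ _ hdeg).trans ?_
      rw [nsmul_eq_mul]
      gcongr
    have e : N ^ 4 / (16 * κ ^ 2) = N ^ 4 / (32 * κ ^ 2) + N ^ 4 / (32 * κ ^ 2) := by ring
    have : N ^ 2 * (2 * N) ≤ N ^ 4 / (32 * κ ^ 2) := by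
      rw [le_div_iff₀ (by positivity)]
      nlinarith [mul_le_mul_of_nonneg_left hN (by positivity : 0 ≤ N ^ 3)]
    linarith
  -- count the paths `l - q - l' - o`
  let S : Finset (Σ _ : α, β × β) := P1.sigma (fun a => (L2.filter (fun b => r a b)).offDiag)
  have hS : (S.card : ℝ) = ∑ a ∈ P1, (((L2.filter (fun b => r a b)).offDiag).card : ℝ) := by
    rw [← Nat.cast_sum, ← card_sigma]
  let Q : (Σ _ : α, β × β) → α → Prop := fun s o => r o s.2.2 ∧ o ≠ s.1
  have h7 : N ^ 5 / (256 * κ ^ 3) ≤ ∑ s ∈ S, ((P1.filter (fun o => Q s o)).card : ℝ) := by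
    calc N ^ 5 / (256 * κ ^ 3) = N ^ 4 / (32 * κ ^ 2) * (N / (8 * κ)) := by ring
      _ ≤ S.card * (N / (8 * κ)) := by
          rw [hS]; exact mul_le_mul_of_nonneg_right h6 (by positivity)
      _ ≤ _ := by
          rw [← nsmul_eq_mul]
          refine card_nsmul_le_sum _ _ _ fun s hs => ?_
          simp only [S, mem_sigma, mem_offDiag, mem_filter] at hs
          have hrich := (mem_filter.1 hs.2.2.1.1).2
          have hsub : ((P1.filter (fun a => r a s.2.2)).card : ℝ) ≤
              (P1.filter (fun o => Q s o)).card + 1 := by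
            rw [← Nat.cast_one, ← Nat.cast_add, Nat.cast_le]
            refine (card_le_card (t := insert s.1 (P1.filter (fun o => Q s o))) ?_).trans
              (card_insert_le _ _)
            intro x hx
            rw [mem_filter] at hx
            rw [mem_insert, mem_filter]
            by_cases hxs : x = s.1
            · exact Or.inl hxs
            · exact Or.inr ⟨hx.1, hx.2, hxs⟩
          have e : N / (4 * κ) = N / (8 * κ) + N / (8 * κ) := by ring
          have : 1 ≤ N / (8 * κ) := by
            rw [le_div_iff₀ (by positivity)]; linarith
          linarith
  rw [sum_card_filter_comm S P1 Q] at h7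
  obtain ⟨o, ho, h8⟩ : ∃ o ∈ P1, N ^ 3 / (256 * κ ^ 3) ≤
      ((S.filter (fun s => Q s o)).card : ℝ) := by
    by_contra! hcon
    have hne : P1.Nonempty := by
      rw [nonempty_iff_ne_empty]; intro h0
      rw [h0, sum_empty] at h4
      have : 0 < N ^ 3 / (4 * κ) := by positivity
      linarith
    have h9 := sum_lt_sum_of_nonempty hne hcon
    rw [sum_const, nsmul_eq_mul] at h9
    have h10 : (P1.card : ℝ) * (N ^ 3 / (256 * κ ^ 3)) ≤ N ^ 2 * (N ^ 3 / (256 * κ ^ 3)) :=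
      mul_le_mul_of_nonneg_right hP1N (by positivity)
    have e : N ^ 2 * (N ^ 3 / (256 * κ ^ 3)) = N ^ 5 / (256 * κ ^ 3) := by ring
    linarith
  refine ⟨P1, filter_subset _ _, L2, hL2L0.trans (filter_subset _ _), fun b hb => ?_, o, ho,
    hdeg o ho, h8.trans ?_⟩
  · refine ⟨(mem_filter.1 hb).2, ?_⟩
    exact le_trans (Nat.cast_le.2 (card_le_card (filter_subset_filter _ (filter_subset _ _))))
      (not_lt.1 (mem_filter.1 (hL2L0 hb)).2)
  · rw [Nat.cast_le]
    refine card_le_card_of_injOn (fun s => s.2) ?_ ?_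
    · rintro ⟨q, l, l'⟩ hs
      simp only [S, Q, mem_coe, mem_filter, mem_sigma, mem_offDiag, mem_product] at hs ⊢
      obtain ⟨⟨hq, ⟨hl, hql⟩, ⟨hl', hql'⟩, hne⟩, hol', hoq⟩ := hs
      -- If o were on l too, then l and l' would share the distinct points o and q.
      refine ⟨⟨hl, hl'⟩, hol', fun hol => ?_, q, hq, hql, hql'⟩
      exact (hr o q l l' hol hol' hql hql').elim hoq hne
    · rintro ⟨q, l, l'⟩ hs ⟨q', m, m'⟩ hs' h
      simp only [S, Q, mem_coe, mem_filter, mem_sigma, mem_offDiag] at hs hs'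
      simp only [Prod.mk.injEq] at h
      obtain ⟨rfl, rfl⟩ := h
      have := (hr q q' l l' hs.1.2.1.2 hs.1.2.2.1.2 hs'.1.2.1.2 hs'.1.2.2.1.2).resolve_right
        hs.1.2.2.2
      rw [this]

end LinearSpaces

/-! ### The projective change of coordinates and the Möbius count. -/

section Plane
variable {F : Type*} [Field F]

/-- Incidence of a point with the line `y = m x + b`, given as the pair `(m, b)`. -/
def OnLine (q l : F × F) : Prop := q.2 = l.1 * q.1 + l.2

instance [DecidableEq F] (q l : F × F) : Decidable (OnLine q l) := inferInstanceAs (Decidable (_ = _))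

theorem OnLine.eq_or_eq {q q' l l' : F × F} (h₁ : OnLine q l) (h₂ : OnLine q l')
    (h₃ : OnLine q' l) (h₄ : OnLine q' l') : q = q' ∨ l = l' := by
  unfold OnLine at *
  have : (l.1 - l'.1) * (q.1 - q'.1) = 0 := by linear_combination -h₁ + h₂ + h₃ - h₄
  rcases mul_eq_zero.1 this with h | h
  · right
    have h := sub_eq_zero.1 h
    exact Prod.ext h (by rw [h] at h₁; exact add_left_cancel (h₁.symm.trans h₂))
  · left
    have h := sub_eq_zero.1 h
    exact Prod.ext h (by rw [h₁, h₃, h])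

variable [DecidableEq F]

/-- Many incidences force the inverted first coordinates, seen from some point of the plane, to
concentrate on an affine copy of a small subfield. -/
theorem exists_subfield_of_many_incidences [Finite F] (P L : Finset (F × F)) (N κ K K' : ℝ)
    (hκ : 1 ≤ κ) (hK : K = 128 * (256 * κ ^ 3) ^ 3)
    (hK' : K' = 2 * (2 ^ 12 * K ^ 5) ^ 6 * (6 * K) ^ 8)
    (hbig : 16 * 6 ^ 8 * 7 ^ 7 * K ^ 10 * K' ^ 15 < 2 * N) (hKN : K ≤ N)
    (hP : (P.card : ℝ) ≤ N ^ 2) (hL : (L.card : ℝ) ≤ N ^ 2)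
    (hI : N ^ 3 / κ ≤ ∑ l ∈ L, ((P.filter (fun q => OnLine q l)).card : ℝ)) :
    N / (4 * κ) ≤ (P.image Prod.fst).card ∧
    ∃ (z : F) (R : Subfield F) (c e : F), c ≠ 0 ∧ ∃ A' : Finset F,
      (∀ a ∈ A', a ≠ 0 ∧ z + a⁻¹ ∈ P.image Prod.fst) ∧
      2 * N / (4 * 6 ^ 4 * K ^ 5 * K') ≤ A'.card ∧ (∀ a ∈ A', ∃ g ∈ R, a = c * g + e) ∧
      (Nat.card R : ℝ) ≤ 4 * (7 ^ 7 * K' ^ 15) * (2 * N) := by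
  have hκ0 : 0 < κ := by linarith
  have hκ2 : κ ^ 2 ≤ κ ^ 9 := pow_le_pow_right₀ hκ (by norm_num)
  have hK2 : K = 128 * 256 ^ 3 * κ ^ 9 := by rw [hK]; ring
  have hκ9 : 1 ≤ κ ^ 9 := one_le_pow₀ hκ
  obtain ⟨P₁, hP₁, L₁, hL₁, hrich, ⟨o₁, o₂⟩, ho, hodeg, hcount⟩ :=
    exists_center P L OnLine (fun _ _ _ _ h1 h2 h3 h4 => OnLine.eq_or_eq h1 h2 h3 h4) N κ hκ
      (by linarith) hP hL hI
  have hN0 : 0 < N := by linarith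
  have hpos : 0 < N ^ 3 / (256 * κ ^ 3) := by positivity
  refine ⟨?_, ?_⟩
  · have hne : ((L₁ ×ˢ L₁).filter (fun y => OnLine (o₁, o₂) y.2 ∧ ¬ OnLine (o₁, o₂) y.1 ∧
          ∃ q ∈ P₁, OnLine q y.1 ∧ OnLine q y.2)).Nonempty := by
      rw [← card_pos, ← Nat.cast_pos (α := ℝ)]
      linarith
    obtain ⟨⟨l, l'⟩, hl⟩ := hne
    rw [mem_filter, mem_product] at hl
    refine (hrich l hl.1.1).1.trans (Nat.cast_le.2 ?_)
    refine card_le_card_of_injOn Prod.fst ?_ ?_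
    · intro q hq
      rw [mem_coe, mem_filter] at hq
      exact mem_coe.2 (mem_image_of_mem _ (hP₁ hq.1))
    · intro q hq q' hq' h
      rw [mem_coe, mem_filter] at hq hq'
      refine Prod.ext h ?_
      rw [hq.2, hq'.2, h]
  -- If l = (m, b) meets the line of slope d through o at abscissa x, then s(l) = (d - m)(x - o₁).
  -- So (x - o₁)⁻¹ = -m/s + d/s, the projection of (-m/s, 1/s) in direction d.
  let s : F × F → F := fun l => l.1 * o₁ + l.2 - o₂
  have hs : ∀ l, ¬ OnLine (o₁, o₂) l → s l ≠ 0 := by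
    intro l hl h
    exact hl (sub_eq_zero.1 h).symm
  set D := (L₁.filter (fun l => OnLine (o₁, o₂) l)).image Prod.fst with hD
  set Λ := (L₁.filter (fun l => ¬ OnLine (o₁, o₂) l)).image (fun l => (-l.1 / s l, 1 / s l)) with hΛ
  let Y : F → Finset F := fun d => (P₁.filter (fun q => q.2 - o₂ = d * (q.1 - o₁) ∧
    q.1 ≠ o₁)).image (fun q => (q.1 - o₁)⁻¹)
  have hDN : (D.card : ℝ) ≤ 2 * N := le_trans (Nat.cast_le.2 card_image_le) hodeg
  have hΛN : (Λ.card : ℝ) ≤ N ^ 2 :=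
    le_trans (Nat.cast_le.2 (card_image_le.trans ((card_filter_le _ _).trans (card_le_card hL₁))))
      hL
  have hYN : ∀ d ∈ D, ((Y d).card : ℝ) ≤ 2 * N := by
    intro d hd
    obtain ⟨l, hl, rfl⟩ := mem_image.1 hd
    rw [mem_filter] at hl
    refine le_trans (Nat.cast_le.2 (card_image_le.trans (card_le_card ?_))) (hrich l hl.1).2
    intro q hq
    rw [mem_filter] at hq ⊢
    refine ⟨hq.1, ?_⟩
    have h1 : o₂ = l.1 * o₁ + l.2 := hl.2
    change q.2 = l.1 * q.1 + l.2
    linear_combination hq.2.1 + h1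
  have hsum : N ^ 3 / (256 * κ ^ 3) ≤
      ∑ d ∈ D, ((Λ.filter (fun l => l.1 + d * l.2 ∈ Y d)).card : ℝ) := by
    refine hcount.trans ?_
    rw [← Nat.cast_sum, ← card_sigma, Nat.cast_le]
    refine card_le_card_of_injOn
      (fun y => ⟨y.2.1, (-y.1.1 / s y.1, 1 / s y.1)⟩) ?_ ?_
    · rintro ⟨l, l'⟩ hy
      simp only [mem_coe, mem_filter, mem_product] at hy
      obtain ⟨⟨hl, hl'⟩, hol', hol, q, hq, hql, hql'⟩ := hy
      simp only [mem_coe, mem_sigma, mem_filter]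
      refine ⟨mem_image.2 ⟨l', mem_filter.2 ⟨hl', hol'⟩, rfl⟩,
        mem_image.2 ⟨l, mem_filter.2 ⟨hl, hol⟩, rfl⟩, ?_⟩
      unfold OnLine at hql hql' hol'
      simp only at hol'
      have hqo : q.1 ≠ o₁ := by
        intro h
        refine hol ?_
        change o₂ = l.1 * o₁ + l.2
        rw [h] at hql hql'
        rw [hol', ← hql', hql]
      refine mem_image.2 ⟨q, mem_filter.2 ⟨hq, ?_, hqo⟩, ?_⟩
      · linear_combination hql' - hol'
      · have h1 := hs l hol
        have h2 := sub_ne_zero.2 hqo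
        have h3 : s l = (l'.1 - l.1) * (q.1 - o₁) := by
          simp only [s]
          linear_combination hql' - hql - hol'
        rw [mul_one_div, ← add_div, inv_eq_one_div, div_eq_div_iff h2 h1, h3]
        ring
    · rintro ⟨l, l'⟩ hy ⟨m, m'⟩ hy' h
      simp only [mem_coe, mem_filter, mem_product] at hy hy'
      simp only [Sigma.mk.injEq, heq_eq_eq, Prod.mk.injEq, one_div, inv_inj] at h
      obtain ⟨h1, h2, h3⟩ := h
      have h4 := hs l hy.2.2.1
      rw [← h3, div_left_inj' h4, neg_inj] at h2
      have e1 : l = m := by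
        refine Prod.ext h2 ?_
        simp only [s] at h3
        rw [h2] at h3
        linear_combination h3
      have e2 : l' = m' := by
        refine Prod.ext h1 ?_
        have h5 : o₂ = l'.1 * o₁ + l'.2 := hy.2.1
        have h6 : o₂ = m'.1 * o₁ + m'.2 := hy'.2.1
        rw [h1] at h5
        exact add_left_cancel (h5.symm.trans h6)
      rw [e1, e2]
  obtain ⟨d, -, R, c, e, hc, A', hA', h1, h2, h3⟩ := exists_subfield_of_small_projections D Λ Y N
    (256 * κ ^ 3) K K' (by positivity) (by linarith) hDN hΛN hYN hsum hK (by linarith) hK' hbig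
  refine ⟨o₁, R, c, e, hc, A', fun a ha => ?_, h1, h2, h3⟩
  obtain ⟨q, hq, rfl⟩ := mem_image.1 (hA' ha)
  rw [mem_filter] at hq
  refine ⟨inv_ne_zero (sub_ne_zero.2 hq.2.2), ?_⟩
  rw [inv_inv, add_sub_cancel]
  exact mem_image_of_mem _ (hP₁ hq.1)

/-- Over the elements fixed by `σ`, a Möbius image of the fixed field meets each parallel affine
copy of it in at most two points, with one possible exception. -/
theorem card_le_of_mobius (σ : F →+* F) (t z c e : F) (ht : σ t ≠ t) (hc : c ≠ 0) (J : Finset F)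
    (A : F → Finset F) (B : ℝ) (hB : 0 ≤ B) (hJ : ∀ j ∈ J, σ j = j)
    (hA : ∀ j ∈ J, ∀ x ∈ A j, ∃ g, σ g = g ∧ x = g + j * t)
    (hAB : ∀ j ∈ J, ((A j).card : ℝ) ≤ B) (A' : Finset F)
    (hA'0 : ∀ a ∈ A', a ≠ 0 ∧ z + a⁻¹ ∈ J.biUnion A)
    (hA' : ∀ a ∈ A', ∃ g, σ g = g ∧ a = c * g + e) :
    (A'.card : ℝ) ≤ 2 * J.card + B := by
  let V : F → Finset F := fun j => A'.filter (fun a => z + a⁻¹ ∈ A j)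
  have hcover : A' ⊆ J.biUnion V := by
    intro a ha
    obtain ⟨j, hj, hz⟩ := mem_biUnion.1 (hA'0 a ha).2
    exact mem_biUnion.2 ⟨j, hj, mem_filter.2 ⟨ha, hz⟩⟩
  have h1 : (A'.card : ℝ) ≤ ∑ j ∈ J, ((V j).card : ℝ) := by
    exact_mod_cast (card_le_card hcover).trans card_biUnion_le
  have hexc : ∀ j ∈ J, ((V j).card : ℝ) ≤ B := by
    intro j hj
    refine le_trans (Nat.cast_le.2 (card_le_card_of_injOn (fun a => z + a⁻¹) ?_ ?_)) (hAB j hj)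
    · intro a ha
      exact (mem_filter.1 ha).2
    · intro a _ b _ h
      exact inv_injective (add_left_cancel h)
  have hgen : ∀ j ∈ J, σ (j * t - z) ≠ j * t - z → ((V j).card : ℝ) ≤ 2 := by
    intro j hj hne
    obtain ⟨y, hy⟩ : ∃ y, y = j * t - z := ⟨_, rfl⟩
    rw [← hy] at hne
    -- From (f + y)(cg + e) = 1 and its image under σ, with f and g fixed, eliminating f leaves a
    -- quadratic in g. It is genuine because σ moves y.
    let q : Polynomial F := Polynomial.C ((y - σ y) * c * σ c) * Polynomial.X ^ 2 +
      Polynomial.C ((y - σ y) * (c * σ e + e * σ c) - (σ c - c)) * Polynomial.X +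
      Polynomial.C ((y - σ y) * e * σ e - (σ e - e))
    have hlead : (y - σ y) * c * σ c ≠ 0 := mul_ne_zero (mul_ne_zero (sub_ne_zero.2 hne.symm) hc)
      ((map_ne_zero σ).2 hc)
    have hq0 : q ≠ 0 := by
      intro h
      have h2 : q.natDegree = 2 := Polynomial.natDegree_quadratic hlead
      rw [h] at h2
      simp at h2
    have hsub : V j ⊆ (q.roots.toFinset).image (fun g => c * g + e) := by
      intro a ha
      obtain ⟨ha', haj⟩ := mem_filter.1 ha
      obtain ⟨g, hg, rfl⟩ := hA' a ha'
      obtain ⟨f, hf, hfe⟩ := hA j hj _ haj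
      have ha0 := (hA'0 _ ha').1
      refine mem_image.2 ⟨g, ?_, rfl⟩
      rw [Multiset.mem_toFinset, Polynomial.mem_roots hq0, Polynomial.IsRoot.def]
      have e1 : (f + y) * (c * g + e) = 1 := by
        have : f + y = (c * g + e)⁻¹ := by rw [hy]; linear_combination -hfe
        rw [this, inv_mul_cancel₀ ha0]
      have e2 : (f + σ y) * (σ c * g + σ e) = 1 := by
        have := congrArg σ e1
        simpa only [map_mul, map_add, map_one, hf, hg] using this
      simp only [q, Polynomial.eval_add, Polynomial.eval_mul, Polynomial.eval_C,
        Polynomial.eval_pow, Polynomial.eval_X]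
      linear_combination (σ c * g + σ e) * e1 - (c * g + e) * e2
    have h2 : (V j).card ≤ 2 := by
      refine (card_le_card hsub).trans (card_image_le.trans ((Multiset.toFinset_card_le _).trans ?_))
      exact (Polynomial.card_roots' q).trans Polynomial.natDegree_quadratic_le
    exact_mod_cast h2
  have h2 : ∑ j ∈ J, ((V j).card : ℝ) ≤
      ∑ j ∈ J, (2 + if σ (j * t - z) = j * t - z then B else 0) := by
    refine sum_le_sum fun j hj => ?_
    split_ifs with h
    · linarith [hexc j hj]
    · linarith [hgen j hj h]
  have h3 : ∑ j ∈ J, (if σ (j * t - z) = j * t - z then B else 0) ≤ B := by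
    rw [← sum_filter, sum_const, nsmul_eq_mul]
    -- Two exceptional j would make (j - j')t fixed by σ, but σ fixes j and j' and moves t.
    have : (J.filter (fun j => σ (j * t - z) = j * t - z)).card ≤ 1 := by
      rw [card_le_one]
      intro j hj j' hj'
      rw [mem_filter, map_sub, map_mul] at hj hj'
      rw [hJ j hj.1] at hj
      rw [hJ j' hj'.1] at hj'
      have : (j - j') * (σ t - t) = 0 := by linear_combination hj.2 - hj'.2
      rcases mul_eq_zero.1 this with h | h
      · exact sub_eq_zero.1 h
      · exact absurd (sub_eq_zero.1 h) ht
    have : ((J.filter (fun j => σ (j * t - z) = j * t - z)).card : ℝ) ≤ 1 := by exact_mod_cast this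
    nlinarith
  rw [sum_add_distrib, sum_const, nsmul_eq_mul] at h2
  linarith

end Plane

/-! ### From affine subspaces to slope–intercept pairs. -/

section Lines
variable {F : Type*} [Field F]

/-- A line is vertical or the graph of an affine function. -/
theorem IsLine.vertical_or_graph {l : AffineSubspace F (F × F)} (hl : IsLine l) :
    (∃ c : F, ∀ q : F × F, q ∈ l ↔ q.1 = c) ∨ ∃ y : F × F, ∀ q : F × F, q ∈ l ↔ OnLine q y := by
  obtain ⟨v, hv0, hv⟩ := finrank_eq_one_iff'.1 (hl : Module.finrank F l.direction = 1)
  have hne : (l : Set (F × F)).Nonempty := by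
    rw [AffineSubspace.nonempty_iff_ne_bot]
    rintro rfl
    unfold IsLine at hl
    rw [AffineSubspace.direction_bot, finrank_bot] at hl
    exact zero_ne_one hl
  obtain ⟨q₀, hq₀⟩ := hne
  have hv0' : (v : F × F) ≠ 0 := fun h => hv0 (Subtype.ext h)
  have hmem : ∀ q : F × F, q ∈ l ↔ ∃ c : F, c • (v : F × F) = q - q₀ := by
    intro q
    rw [← AffineSubspace.vsub_right_mem_direction_iff_mem hq₀]
    constructor
    · intro h
      obtain ⟨c, hc⟩ := hv ⟨_, h⟩
      exact ⟨c, congrArg Subtype.val hc⟩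
    · rintro ⟨c, hc⟩
      rw [vsub_eq_sub, ← hc]
      exact Submodule.smul_mem _ _ v.2
  obtain ⟨⟨a, b⟩, hvmem⟩ := v
  simp only [Prod.ext_iff, Prod.smul_fst, Prod.smul_snd, Prod.fst_sub, Prod.snd_sub,
    smul_eq_mul] at hmem
  by_cases ha : a = 0
  · left
    subst ha
    have hb : b ≠ 0 := fun h => hv0' (Prod.ext rfl h)
    refine ⟨q₀.1, fun q => ?_⟩
    rw [hmem]
    constructor
    · rintro ⟨c, h, -⟩
      linear_combination -h
    · intro h
      exact ⟨(q.2 - q₀.2) / b, by rw [h]; ring, by field_simp⟩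
  · right
    refine ⟨(b / a, q₀.2 - b / a * q₀.1), fun q => ?_⟩
    rw [hmem, OnLine]
    constructor
    · rintro ⟨c, h1, h2⟩
      field_simp
      linear_combination b * h1 - a * h2
    · intro h
      refine ⟨(q.1 - q₀.1) / a, by field_simp, ?_⟩
      rw [h]
      field_simp
      ring

theorem incidences_le_card_mul (P : Finset (F × F)) (L : Finset (AffineSubspace F (F × F))) :
    incidences P L ≤ P.card * L.card := by
  classical
  exact (card_filter_le _ _).trans (card_product P L).le

/-- Reduction of the incidence count to non-vertical lines. -/
theorem incidences_le_card_add [DecidableEq F] (P : Finset (F × F))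
    (L : Finset (AffineSubspace F (F × F))) (hL : ∀ l ∈ L, IsLine l) :
    ∃ L' : Finset (F × F), L'.card ≤ L.card ∧ (incidences P L : ℝ) ≤
      P.card + ∑ l ∈ L', ((P.filter (fun q => OnLine q l)).card : ℝ) := by
  classical
  let V : AffineSubspace F (F × F) → Prop := fun l => ∃ y : F × F, ∀ q : F × F, q ∈ l ↔ OnLine q y
  have hV : ∀ l, ∃ y : F × F, V l → ∀ q : F × F, q ∈ l ↔ OnLine q y := by
    intro l
    by_cases h : V l
    · exact ⟨h.choose, fun _ => h.choose_spec⟩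
    · exact ⟨0, fun h' => absurd h' h⟩
  choose f hf using hV
  refine ⟨(L.filter V).image f, card_image_le.trans (card_filter_le _ _), ?_⟩
  rw [← Nat.cast_sum, ← card_sigma, ← Nat.cast_add, Nat.cast_le, ← card_disjSum]
  -- A point lies on at most one vertical line, so a vertical incidence is recorded by its point
  -- alone.
  refine card_le_card_of_injOn (fun x => if V x.2 then Sum.inr ⟨f x.2, x.1⟩ else Sum.inl x.1) ?_ ?_
  · rintro ⟨q, l⟩ h
    simp only [mem_coe, mem_filter, mem_product] at h
    dsimp only
    split_ifs with hVl
    · rw [mem_coe, inr_mem_disjSum, mem_sigma]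
      exact ⟨mem_image.2 ⟨l, mem_filter.2 ⟨h.1.2, hVl⟩, rfl⟩,
        mem_filter.2 ⟨h.1.1, (hf l hVl q).1 h.2⟩⟩
    · rw [mem_coe, inl_mem_disjSum]
      exact h.1.1
  · rintro ⟨q, l⟩ h ⟨q', l'⟩ h' he
    simp only [mem_coe, mem_filter, mem_product] at h h'
    dsimp only at he
    split_ifs at he with h1 h2 h2
    · simp only [Sum.inr.injEq, Sigma.mk.injEq, heq_eq_eq] at he
      refine Prod.ext he.2 (SetLike.ext fun x => ?_)
      rw [hf l h1, hf l' h2, he.1]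
    · simp only [Sum.inl.injEq] at he
      subst he
      obtain ⟨c, hc⟩ := (hL l h.1.2).vertical_or_graph.resolve_right h1
      obtain ⟨c', hc'⟩ := (hL l' h'.1.2).vertical_or_graph.resolve_right h2
      have e : c = c' := ((hc q).1 h.2).symm.trans ((hc' q).1 h'.2)
      refine Prod.ext rfl (SetLike.ext fun x => ?_)
      rw [hc, hc', e]

end Lines

/-! ### The Frobenius automorphism and the subfields. -/

section Fields
variable {F : Type*} [Field F]

/-- The automorphism `x ↦ x ^ (p ^ 2)` of a field with `p ^ 4` elements: it fixes the subfield `G`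
with `p ^ 2` elements and every proper subfield, and moves each generator over `G`. -/
theorem exists_hom_fixing_subfields {p : ℕ} (hp : p.Prime) (hF : Nat.card F = p ^ 4)
    (G : Subfield F) (hG : Nat.card G = p ^ 2) (t : F)
    (ht : IntermediateField.adjoin G ({t} : Set F) = ⊤) :
    ∃ σ : F →+* F, σ t ≠ t ∧ (∀ g ∈ G, σ g = g) ∧
      ∀ R : Subfield F, Nat.card R ≠ p ^ 4 → ∀ x ∈ R, σ x = x := by
  classical
  have hfin : Finite F := Nat.finite_of_card_ne_zero (by rw [hF]; exact pow_ne_zero _ hp.ne_zero)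
  have := Fintype.ofFinite F
  have := Fintype.ofFinite G
  have hGc : Fintype.card G = p ^ 2 := by rw [← Nat.card_eq_fintype_card, hG]
  have hFc : Fintype.card F = p ^ 4 := by rw [← Nat.card_eq_fintype_card, hF]
  let σ : F →ₐ[G] F := FiniteField.frobeniusAlgHom G F
  have hσ : ∀ x, σ x = x ^ (p ^ 2) := fun x => by
    simp only [σ, FiniteField.coe_frobeniusAlgHom, hGc]
  refine ⟨σ, ?_, fun g hg => σ.commutes ⟨g, hg⟩, ?_⟩
  · intro hσt
    have hall : ∀ x : F, σ x = x := by
      intro x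
      have hx : x ∈ IntermediateField.adjoin G ({t} : Set F) := by rw [ht]; trivial
      induction hx using IntermediateField.adjoin_induction with
      | mem x hx => rw [Set.mem_singleton_iff.1 hx]; exact hσt
      | algebraMap x => exact σ.commutes x
      | add x y _ _ hx hy => rw [map_add, hx, hy]
      | inv x _ hx => rw [map_inv₀, hx]
      | mul x y _ _ hx hy => rw [map_mul, hx, hy]
    have h2 : 2 ≤ p := hp.two_le
    -- If σ were the identity, every unit would satisfy x^(p² - 1) = 1, forcing p⁴ - 1 to divide p²
    -- - 1.
    have hdvd : Fintype.card F - 1 ∣ p ^ 2 - 1 := by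
      rw [← FiniteField.forall_pow_eq_one_iff]
      intro x
      have h := hall x
      rw [hσ, ← Nat.sub_add_cancel (Nat.one_le_pow 2 p hp.pos), pow_succ] at h
      exact Units.ext (mul_right_cancel₀ x.ne_zero (by
        rw [Units.val_one, one_mul, Units.val_pow_eq_pow_val]; exact h))
    rw [hFc] at hdvd
    have h4 : p ^ 2 < p ^ 4 := Nat.pow_lt_pow_right hp.one_lt (by norm_num)
    have h5 : 1 < p ^ 2 := Nat.one_lt_pow (by norm_num) hp.one_lt
    have := Nat.le_of_dvd (by omega) hdvd
    omega
  · intro R hR x hx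
    have := Fintype.ofFinite R
    have hcard : Nat.card R ^ Module.finrank R F = p ^ 4 := by
      rw [← hF, ← Module.natCard_eq_pow_finrank]
    have hpos : 0 < Module.finrank R F := Module.finrank_pos
    obtain ⟨k, -, hk⟩ := (Nat.dvd_prime_pow hp).1 (hcard ▸ dvd_pow_self (Nat.card R) hpos.ne')
    rw [hk, ← pow_mul] at hcard
    have hkm := Nat.pow_right_injective hp.two_le hcard
    have hk4 : k ∣ 4 := ⟨_, hkm.symm⟩
    have hxR : x ^ (p ^ k) = x := by
      have h := FiniteField.pow_card (⟨x, hx⟩ : R)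
      rw [← Nat.card_eq_fintype_card, hk] at h
      exact congrArg Subtype.val h
    change σ x = x
    rw [hσ]
    have hk' : k ≤ 4 := Nat.le_of_dvd (by norm_num) hk4
    -- A subfield has p^k elements with k ∣ 4; for k = 1 and k = 2 its elements satisfy x^(p²) = x.
    interval_cases k
    · omega
    · rw [pow_one] at hxR
      rw [sq, pow_mul, hxR, hxR]
    · exact hxR
    · omega
    · exact absurd hk hR

end Fields

/-! ### Bookkeeping of exponents and conclusion. -/

/-- The constants of the projection theorem are bounded by small powers of `κ`. -/
theorem constants_le (κ K K' : ℝ) (hκ : 2 ^ 100 ≤ κ) (hK : K = 128 * (256 * (2 * κ) ^ 3) ^ 3)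
    (hK' : K' = 2 * (2 ^ 12 * K ^ 5) ^ 6 * (6 * K) ^ 8) :
    0 < K ∧ 0 < K' ∧ K ≤ κ ^ 10 ∧ K' ≤ κ ^ 390 := by
  have hκ1 : 1 ≤ κ := le_trans (by norm_num) hκ
  have hK2 : K = 2 ^ 40 * κ ^ 9 := by rw [hK]; ring
  have hK0 : 0 < K := by rw [hK2]; positivity
  have hKκ : K ≤ κ ^ 10 := by
    rw [hK2, show κ ^ 10 = κ * κ ^ 9 by ring]
    have : (2 : ℝ) ^ 40 ≤ κ := le_trans (by norm_num) hκ
    gcongr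
  have hK94 : 2 ^ 94 ≤ K := by
    rw [hK2]
    have : κ ≤ κ ^ 9 := le_self_pow₀ hκ1 (by norm_num)
    nlinarith
  refine ⟨hK0, by rw [hK']; positivity, hKκ, ?_⟩
  calc K' = (2 ^ 73 * 6 ^ 8) * K ^ 38 := by rw [hK']; ring
    _ ≤ K * K ^ 38 := by
        gcongr
        exact le_trans (by norm_num) hK94
    _ = K ^ 39 := by ring
    _ ≤ (κ ^ 10) ^ 39 := pow_le_pow_left₀ hK0.le hKκ 39
    _ = κ ^ 390 := by rw [← pow_mul]

/-- The theorem for large n, with every quantity a power of κ = n^(1/12838). Numerical constants and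
the cᵢ are absorbed into spare factors of κ. -/
theorem incidences_le_of_large {p : ℕ} (hp : p.Prime) {F : Type*} [Field F] [DecidableEq F]
    (hF : Nat.card F = p ^ 4) (G : Subfield F) (hG : Nat.card G = p ^ 2) (t : F)
    (ht : IntermediateField.adjoin G ({t} : Set F) = ⊤) (κ : ℝ) (hκ : 2 ^ 100 ≤ κ)
    (P : Finset (F × F)) (hP : (P.card : ℝ) = κ ^ 12838)
    (hPp : ((P.image Prod.fst).card : ℝ) ≤ κ * (p : ℝ) ^ 2)
    (J : Finset F) (A : F → Finset F) (hJG : ∀ j ∈ J, j ∈ G) (hJ : (J.card : ℝ) ≤ κ ^ 5122)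
    (hA : ∀ j ∈ J, ∀ x ∈ A j, ∃ g ∈ G, x = g + j * t)
    (hAc : ∀ j ∈ J, ((A j).card : ℝ) ≤ κ ^ 5122) (hPA : P.image Prod.fst = J.biUnion A)
    (L : Finset (AffineSubspace F (F × F))) (hL : ∀ l ∈ L, IsLine l)
    (hLc : (L.card : ℝ) = κ ^ 12838) : (incidences P L : ℝ) ≤ κ ^ 19256 := by
  by_contra! hI
  have hfin : Finite F := Nat.finite_of_card_ne_zero (by rw [hF]; exact pow_ne_zero _ hp.ne_zero)
  have hκ1 : 1 ≤ κ := le_trans (by norm_num) hκ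
  have hκ0 : 0 < κ := by linarith
  have hpw : ∀ {a b : ℕ}, a ≤ b → κ ^ a ≤ κ ^ b := fun h => pow_le_pow_right₀ hκ1 h
  have hκ8 : 8 ≤ κ := le_trans (by norm_num) hκ
  obtain ⟨L', hL', hinc⟩ := incidences_le_card_add P L hL
  obtain ⟨N, hN⟩ : ∃ N, N = κ ^ 6419 := ⟨_, rfl⟩
  have hN0 : 0 < N := by rw [hN]; positivity
  have hN2 : κ ^ 12838 = N ^ 2 := by rw [hN, ← pow_mul]
  have hN3 : κ ^ 19256 * κ = N ^ 3 := by rw [hN, ← pow_mul, ← pow_succ]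
  -- The density loss is 2κ once vertical lines are removed, then 256(·)³ from the choice of centre
  -- and 128(·)³ from the choice of two directions.
  obtain ⟨K, hK⟩ : ∃ K, K = 128 * (256 * (2 * κ) ^ 3) ^ 3 := ⟨_, rfl⟩
  obtain ⟨K', hK'⟩ : ∃ K', K' = 2 * (2 ^ 12 * K ^ 5) ^ 6 * (6 * K) ^ 8 := ⟨_, rfl⟩
  obtain ⟨hK0, hK'0, hKκ, hK'κ⟩ := constants_le κ K K' hκ hK hK'
  have hsum : N ^ 3 / (2 * κ) ≤ ∑ l ∈ L', ((P.filter (fun q => OnLine q l)).card : ℝ) := by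
    have e : N ^ 3 / (2 * κ) = κ ^ 19256 / 2 := by rw [← hN3]; field_simp
    have h1 : κ ^ 12838 * 2 ≤ κ ^ 19256 := by
      calc κ ^ 12838 * 2 ≤ κ ^ 12838 * κ := by gcongr; linarith
        _ = κ ^ 12839 := (pow_succ _ _).symm
        _ ≤ _ := hpw (by norm_num)
    rw [e]
    linarith
  have hbig : 16 * 6 ^ 8 * 7 ^ 7 * K ^ 10 * K' ^ 15 < 2 * N := by
    calc 16 * 6 ^ 8 * 7 ^ 7 * K ^ 10 * K' ^ 15 ≤ κ * (κ ^ 10) ^ 10 * (κ ^ 390) ^ 15 := by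
          gcongr
          exact le_trans (by norm_num) hκ
      _ = κ ^ 5951 := by ring
      _ ≤ N := by rw [hN]; exact hpw (by norm_num)
      _ < 2 * N := by linarith
  have hKN : K ≤ N := by rw [hN]; exact hKκ.trans (hpw (by norm_num))
  obtain ⟨hrich, z, R, c, e, hc, A', hA', hA'c, hA'R, hR⟩ := exists_subfield_of_many_incidences P L'
    N (2 * κ) K K' (by linarith) hK hK' hbig hKN (by rw [hP, hN2])
    (by rw [← hN2, ← hLc]; exact_mod_cast hL') hsum
  obtain ⟨σ, hσt, hσG, hσR⟩ := exists_hom_fixing_subfields hp hF G hG t ht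
  -- |R| is at most κ^12270, whereas a rich line and |A| ≤ κp² force p⁴ ≥ κ^12832.
  have hRF : Nat.card R ≠ p ^ 4 := by
    intro h
    have h1 : (p : ℝ) ^ 4 ≤ κ ^ 12270 := by
      calc (p : ℝ) ^ 4 = (Nat.card R : ℝ) := by rw [h]; push_cast; rfl
        _ ≤ _ := hR
        _ = (8 * 7 ^ 7) * K' ^ 15 * N := by ring
        _ ≤ κ * (κ ^ 390) ^ 15 * N := by
            gcongr
            exact le_trans (by norm_num) hκ
        _ = κ ^ 5851 * N := by ring
        _ = κ ^ 12270 := by rw [hN, ← pow_add]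
    have h2 : κ ^ 6416 ≤ (p : ℝ) ^ 2 := by
      have h3 := hrich.trans hPp
      rw [div_le_iff₀ (by positivity)] at h3
      have h4 : N = κ ^ 6416 * κ ^ 3 := by rw [hN, ← pow_add]
      rw [h4] at h3
      refine le_of_mul_le_mul_right (h3.trans ?_) (by positivity : 0 < κ ^ 3)
      calc κ * (p : ℝ) ^ 2 * (4 * (2 * κ)) = (p : ℝ) ^ 2 * (8 * κ ^ 2) := by ring
        _ ≤ (p : ℝ) ^ 2 * (κ * κ ^ 2) := by gcongr
        _ = _ := by ring
    have h3 : κ ^ 12832 ≤ (p : ℝ) ^ 4 := by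
      calc κ ^ 12832 = (κ ^ 6416) ^ 2 := by rw [← pow_mul]
        _ ≤ ((p : ℝ) ^ 2) ^ 2 := pow_le_pow_left₀ (by positivity) h2 2
        _ = _ := by ring
    have h4 : κ ^ 12270 < κ ^ 12832 := pow_lt_pow_right₀ (by linarith) (by norm_num)
    linarith
  have hcard := card_le_of_mobius σ t z c e hσt hc J A (κ ^ 5122) (by positivity)
    (fun j hj => hσG j (hJG j hj))
    (fun j hj x hx => by
      obtain ⟨g, hg, h⟩ := hA j hj x hx
      exact ⟨g, hσG g hg, h⟩) hAc A' (by rw [← hPA]; exact hA')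
    (fun a ha => by
      obtain ⟨g, hg, h⟩ := hA'R a ha
      exact ⟨g, hσR R hRF g hg, h⟩)
  have h1 : (A'.card : ℝ) ≤ κ ^ 5123 := by
    calc (A'.card : ℝ) ≤ 3 * κ ^ 5122 := by linarith
      _ ≤ κ * κ ^ 5122 := by gcongr; linarith
      _ = _ := (pow_succ' _ _).symm
  have h2 := hA'c.trans h1
  rw [div_le_iff₀ (by positivity)] at h2
  -- The Möbius bound κ^5123 on |A'| meets the lower bound 2N/(4·6⁴K⁵K'); the losses reach only
  -- κ^5564, below N = κ^6419.
  have h3 : κ ^ 5123 * (4 * 6 ^ 4 * K ^ 5 * K') ≤ N := by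
    calc κ ^ 5123 * (4 * 6 ^ 4 * K ^ 5 * K') ≤ κ ^ 5123 * (κ * (κ ^ 10) ^ 5 * κ ^ 390) := by
          gcongr
          exact le_trans (by norm_num) hκ
      _ = κ ^ 5123 * κ ^ 441 := by ring
      _ = κ ^ 5564 := by rw [← pow_add]
      _ ≤ N := by rw [hN]; exact hpw (by norm_num)
  linarith

end

theorem mainTheorem3 (c₁ c₂ c₃ c₄ : ℝ) :
    ∃ K : ℝ, 0 < K ∧
      ∀ (p : ℕ), p.Prime →
      ∀ (F : Type*) [Field F] [DecidableEq F], Nat.card F = p ^ 4 →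
      -- `G` is the subfield with `p ^ 2` elements, `t` a defining element of `F` over `G`
      ∀ (G : Subfield F), Nat.card G = p ^ 2 →
      ∀ (t : F), IntermediateField.adjoin G ({t} : Set F) = ⊤ →
      ∀ (n : ℕ) (P : Finset (F × F)), P.card = n →
      (p : ℝ) ^ ((6419 : ℝ) / 2560) ≤ c₁ * (n : ℝ) →
      ((P.image Prod.fst).card : ℝ) ≤ c₂ * (p : ℝ) ^ 2 →
      ∀ (J : Finset F) (A : F → Finset F),
      (∀ j ∈ J, j ∈ G) →
      (J.card : ℝ) ≤ c₃ * max (p : ℝ) ((n : ℝ) ^ ((2560 : ℝ) / 6419)) →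
      (∀ j ∈ J, ∀ x ∈ A j, ∃ g ∈ G, x = g + j * t) →
      (∀ j ∈ J, ((A j).card : ℝ) ≤ c₄ * max (p : ℝ) ((n : ℝ) ^ ((2560 : ℝ) / 6419))) →
      P.image Prod.fst = J.biUnion A →
      ∀ (L : Finset (AffineSubspace F (F × F))), (∀ l ∈ L, IsLine l) → L.card = n →
        (incidences P L : ℝ) ≤ K * (n : ℝ) ^ ((3 : ℝ) / 2 - 1 / 12838) := by
  obtain ⟨C, hC⟩ : ∃ C, C = 1 + |c₁| + |c₂| + |c₃| + |c₄| := ⟨_, rfl⟩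
  have hC1 : 1 ≤ C ∧ c₁ ≤ C ∧ c₂ ≤ C ∧ c₃ ≤ C ∧ c₄ ≤ C := by
    have h1 := abs_nonneg c₁
    have h2 := abs_nonneg c₂
    have h3 := abs_nonneg c₃
    have h4 := abs_nonneg c₄
    refine ⟨by linarith, ?_, ?_, ?_, ?_⟩
    · linarith [le_abs_self c₁]
    · linarith [le_abs_self c₂]
    · linarith [le_abs_self c₃]
    · linarith [le_abs_self c₄]
  obtain ⟨hC1, h₁, h₂, h₃, h₄⟩ := hC1
  -- The threshold for κ: 2^100 dominates the numerical constants and C the cᵢ. Below it, the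
  -- trivial bound n² = κ^25676 is enough.
  obtain ⟨κ₀, hκ₀⟩ : ∃ κ₀, κ₀ = 2 ^ 100 * C := ⟨_, rfl⟩
  have hκ₀1 : 2 ^ 100 ≤ κ₀ := by rw [hκ₀]; exact le_mul_of_one_le_right (by positivity) hC1
  have hκ₀C : C ≤ κ₀ := by rw [hκ₀]; exact le_mul_of_one_le_left (by linarith) (by norm_num)
  have hκ₀' : 1 ≤ κ₀ := hC1.trans hκ₀C
  refine ⟨κ₀ ^ 25676, by positivity, ?_⟩
  intro p hp F _ _ hF G hG t ht n P hPn hpn hPp J A hJG hJ hA hAc hPA L hL hLn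
  have hinc : incidences P L ≤ n ^ 2 := by
    rw [sq]
    nth_rw 1 [← hPn]
    rw [← hLn]
    exact incidences_le_card_mul P L
  rcases Nat.eq_zero_or_pos n with hn | hn
  · subst hn
    have h0 : incidences P L = 0 := Nat.le_zero.1 hinc
    rw [h0, Nat.cast_zero]
    exact mul_nonneg (pow_nonneg (by linarith) _) (Real.rpow_nonneg le_rfl _)
  obtain ⟨κ, hκ⟩ : ∃ κ : ℝ, κ = (n : ℝ) ^ ((1 : ℝ) / 12838) := ⟨_, rfl⟩
  have hn1 : (1 : ℝ) ≤ n := by exact_mod_cast hn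
  have hκ1 : 1 ≤ κ := by rw [hκ]; exact Real.one_le_rpow hn1 (by norm_num)
  have hκ0 : 0 ≤ κ := by linarith
  have hpow : ∀ m : ℕ, κ ^ m = (n : ℝ) ^ ((m : ℝ) / 12838) := fun m => by
    rw [hκ, ← Real.rpow_mul_natCast (by positivity)]
    congr 1
    ring
  have hnκ : (n : ℝ) = κ ^ 12838 := by
    rw [hpow, show ((12838 : ℕ) : ℝ) / 12838 = 1 by norm_num, Real.rpow_one]
  have hmain : (n : ℝ) ^ ((3 : ℝ) / 2 - 1 / 12838) = κ ^ 19256 := by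
    rw [hpow]; congr 1; norm_num
  have hmid : (n : ℝ) ^ ((2560 : ℝ) / 6419) = κ ^ 5120 := by
    rw [hpow]; congr 1; norm_num
  rw [hmain]
  rcases lt_or_ge κ κ₀ with hlt | hge
  · calc (incidences P L : ℝ) ≤ (n : ℝ) ^ 2 := by exact_mod_cast hinc
      _ = κ ^ 25676 := by rw [hnκ, ← pow_mul]
      _ ≤ κ₀ ^ 25676 := pow_le_pow_left₀ hκ0 hlt.le _
      _ ≤ κ₀ ^ 25676 * κ ^ 19256 := le_mul_of_one_le_right (by positivity) (one_le_pow₀ hκ1)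
  have hCκ : C ≤ κ := hκ₀C.trans hge
  -- The lower bound on n makes both terms of the maximum at most Cκ^5120, as n^(2560/6419) =
  -- κ^5120.
  have hpκ : (p : ℝ) ≤ κ * κ ^ 5120 := by
    have h5 : (p : ℝ) ^ ((6419 : ℝ) / 2560) ≤ C * n :=
      hpn.trans (mul_le_mul_of_nonneg_right h₁ (by positivity))
    calc (p : ℝ) = ((p : ℝ) ^ ((6419 : ℝ) / 2560)) ^ ((2560 : ℝ) / 6419) := by
          rw [← Real.rpow_mul (by positivity)]
          norm_num
      _ ≤ (C * n) ^ ((2560 : ℝ) / 6419) := Real.rpow_le_rpow (by positivity) h5 (by norm_num)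
      _ = C ^ ((2560 : ℝ) / 6419) * κ ^ 5120 := by
          rw [Real.mul_rpow (by linarith) (by positivity), hmid]
      _ ≤ C ^ (1 : ℝ) * κ ^ 5120 := by
          gcongr
          norm_num
      _ ≤ κ * κ ^ 5120 := by
          rw [Real.rpow_one]
          gcongr
  have hmax : max (p : ℝ) ((n : ℝ) ^ ((2560 : ℝ) / 6419)) ≤ κ * κ ^ 5120 := by
    rw [hmid]
    exact max_le hpκ (le_mul_of_one_le_left (by positivity) hκ1)
  have hbound : ∀ c : ℝ, c ≤ C →
      c * max (p : ℝ) ((n : ℝ) ^ ((2560 : ℝ) / 6419)) ≤ κ ^ 5122 := by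
    intro c hc
    calc _ ≤ κ * max (p : ℝ) ((n : ℝ) ^ ((2560 : ℝ) / 6419)) :=
          mul_le_mul_of_nonneg_right (hc.trans hCκ) (le_max_of_le_left (by positivity))
      _ ≤ κ * (κ * κ ^ 5120) := mul_le_mul_of_nonneg_left hmax hκ0
      _ = κ ^ 5122 := by rw [← pow_succ', ← pow_succ']
  have hlarge := incidences_le_of_large hp hF G hG t ht κ (hκ₀1.trans hge) P
    (by rw [hPn, hnκ]) (hPp.trans (mul_le_mul_of_nonneg_right (h₂.trans hCκ) (by positivity)))
    J A hJG (hJ.trans (hbound _ h₃)) hA (fun j hj => (hAc j hj).trans (hbound _ h₄)) hPA L hL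
    (by rw [hLn, hnκ])
  exact hlarge.trans (le_mul_of_one_le_left (by positivity) (one_le_pow₀ hκ₀'))
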